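/- Conventions. Graphs are simplicial (no loops or multiple edges), with edges of length $1$ and the path metric $d$; a graph is $\delta$-hyperbolic if it is connected and its geodesic triangles are $\delta$-slim. Induced subgraphs of a graph $X$ are identified with their vertex sets; for an induced subgraph $F$, $lk(F)$ is the set of vertices of $X$ adjacent to all vertices of $F$. Let $X$ be a simplicial graph. A graph factor system of complexity $n$ on $X$ is a collection $\mathfrak F$ of non-empty induced subgraphs of $X$ (called domains) such that $X\in\mathfrak F$; $lk(v)\in\mathfrak F$ for every vertex $v$ with $lk(v)\neq\emptyset$; $F_1\cap F_2\in\mathfrak F$ for all $F_1,F_2\in\mathfrak F$ with $F_1\cap F_2\ne\emptyset$; and every chain $F_1\subsetneq\dots\subsetneq F_k$ in $\mathfrak F$ has $k<n$. For an induced subgraph $F$ of $X$, an $F$-graph is a graph whose vertices are the maximal cliques of $F$. Let $W$ be an $X$-graph. For each domain $F\neq X$ take a new vertex $b_F$. The augmented graph $CX$ has vertex set $V(X)\cup\{b_F : F\in\mathfrak F,\ F\ne X\}$; two distinct vertices $v,w$ of $X$ are adjacent in it if they are adjacent in $X$ or lie in two $W$-adjacent maximal cliques ($v$ in one, $w$ in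 the other), $b_F$ is adjacent to exactly the vertices of $F$. For a domain $F$, $CF$ is the subgraph of $CX$ induced on $V(F)\cup\{b_H: H\in\mathfrak F,\ H\subsetneq F\}$; the projection part of $F$ is $$PF=lk(F)\cup\{b_H: H\in\mathfrak F,\ H\subseteq lk(F)\}\cup\{b_H : H\in\mathfrak F,\ F\subseteq H\neq X\},$$ and $Y_F$ is the subgraph of $CX$ induced on the complement of $PF$ (it contains $CF$). The triple $(X,W,\mathfrak F)$ is an $(n,\delta)$-CHHF, where $\delta>0$, if $\mathfrak F$ is a graph factor system of complexity $n$ and the following hold. 1. (Hyperbolicity) For every domain $F$, $CF$ is $\delta$-hyperbolic and the inclusion $CF\to Y_F$ is a $(\delta,\delta)$-quasi-isometric embedding. 2. (Hierarchy) There are $F$-graphs $W^F$, one for each domain $F$, such that for all domains $F'\subseteq F$: (a) the augmented graph of $F'$ computed in the triple $(F,W^F,\{H\in\mathfrak F: H\subseteq F\})$ equals $CF'$; (b) for every (possibly empty) maximal clique $x$ of $lk(F')\cap F$ there is a map from the vertices of $W^{F'}$ to those of $W^F$ that sends adjacent vertices to equal or adjacent ones and sends each maximal clique $w$ of $F'$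 to a maximal clique of $F$ containing $x\cup w$. For a domain $F$ and a vertex $x$ of $Y_F$ let $p_F(x)=\{a\in CF : d_{Y_F}(x,a)\le d_{Y_F}(x,CF)+1\}$ be its coarse closest-point projection. **Lemma 3.22.** For all $n\in\mathbb N$ and $\delta>0$ there is a constant $C=C(n,\delta)$ such that, for every $(n,\delta)$-CHHF $(X,W,\mathfrak F)$, every domain $F\in\mathfrak F$ with $F\neq X$ and all vertices $x,y$ of $Y_F$: if $d_{CF}(a,b)\ge C$ for some $a\in p_F(x)$, $b\in p_F(y)$ (in particular, if $d_{CF}(p_F(x),p_F(y))\ge C$), then every geodesic of $CX$ from $x$ to $y$ contains a vertex of $PF$. -/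

import Mathlib

namespace CHHF

/-! ### Coarse geometry of graphs (edges have length one, `SimpleGraph.dist` is the path metric) -/

/-- A walk that is a geodesic between its endpoints. -/
def IsGeodesic {A : Type*} {H : SimpleGraph A} {a b : A} (p : H.Walk a b) : Prop :=
  p.length = H.dist a b

/-- A `δ`-hyperbolic graph: it is connected and its geodesic triangles are `δ`-slim. -/
def IsHyperbolic {A : Type*} (H : SimpleGraph A) (δ : ℝ) : Prop :=
  H.Connected ∧
    ∀ (a b c : A) (p : H.Walk a b) (q : H.Walk b c) (r : H.Walk a c),
      IsGeodesic p → IsGeodesic q → IsGeodesic r →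
        ∀ u ∈ p.support, ∃ v, (v ∈ q.support ∨ v ∈ r.support) ∧ (H.dist u v : ℝ) ≤ δ

/-- A `(K, K)`-quasi-isometric embedding from a connected graph `H` to a graph `H'`
(the image has to lie in one component of `H'`, so that all distances are finite). -/
def IsQIEmbedding {A B : Type*} (H : SimpleGraph A) (H' : SimpleGraph B) (K : ℝ) (f : A → B) :
    Prop :=
  ∀ a b : A, H'.Reachable (f a) (f b) ∧
    (H.dist a b : ℝ) / K - K ≤ (H'.dist (f a) (f b) : ℝ) ∧
    (H'.dist (f a) (f b) : ℝ) ≤ K * (H.dist a b : ℝ) + K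

/-! ### Links, maximal cliques, factor systems

Induced subgraphs of the graph `G` are given by their vertex sets. -/

/-- The link of an induced subgraph: the vertices adjacent to all its vertices. -/
def link {V : Type*} (G : SimpleGraph V) (S : Set V) : Set V :=
  {v | ∀ u ∈ S, G.Adj u v}

/-- The maximal cliques of the induced subgraph of `G` on `S`. If `S` is empty, the empty
clique is the only one. -/
def MaxClique {V : Type*} (G : SimpleGraph V) (S : Set V) : Type _ :=
  {c : Set V // Maximal (fun c => c ⊆ S ∧ G.IsClique c) c}

/-- A graph factor system `𝔉` on `G` all of whose strict chains have fewer than `n` members.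
Its members, the domains, are non-empty induced subgraphs. -/
structure IsGraphFactorSystem {V : Type*} (G : SimpleGraph V) (𝔉 : Set (Set V)) (n : ℕ) :
    Prop where
  nonempty_of_mem : ∀ F ∈ 𝔉, F.Nonempty
  univ_mem : Set.univ ∈ 𝔉
  link_mem : ∀ v : V, (link G {v}).Nonempty → link G {v} ∈ 𝔉
  inter_mem : ∀ F₁ ∈ 𝔉, ∀ F₂ ∈ 𝔉, (F₁ ∩ F₂).Nonempty → F₁ ∩ F₂ ∈ 𝔉
  chain_lt : ∀ (k : ℕ) (c : Fin k → Set V), (∀ i, c i ∈ 𝔉) → StrictMono c → k < n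

/-! ### Augmented graphs, projection parts, complement graphs

`Sum.inl v` stands for the vertex `v` and `Sum.inr F` for the projection vertex `b_F`. -/

/-- The three kinds of edges of an augmented graph, where `W` is an `S`-graph, that is, a graph
on the maximal cliques of `S`: edges of `G`, additional edges, and edges from `b_F` to the vertices
of `F`. The augmented graphs are obtained from it by restricting to the right vertices. -/
def edgeGraph {V : Type*} (G : SimpleGraph V) (S : Set V) (W : SimpleGraph (MaxClique G S)) :
    SimpleGraph (V ⊕ Set V) where
  Adj
    | .inl v, .inl w =>
        v ≠ w ∧ (G.Adj v w ∨ ∃ x y : MaxClique G S, W.Adj x y ∧ v ∈ x.1 ∧ w ∈ y.1)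
    | .inl v, .inr F => v ∈ F
    | .inr F, .inl v => v ∈ F
    | .inr _, .inr _ => False
  symm := ⟨by
    rintro (v | F) (w | F') h
    · obtain ⟨hne, h | ⟨x, y, hxy, hv, hw⟩⟩ := h
      · exact ⟨hne.symm, Or.inl h.symm⟩
      · exact ⟨hne.symm, Or.inr ⟨y, x, hxy.symm, hw, hv⟩⟩
    · exact h
    · exact h
    · exact h⟩
  loopless := ⟨by
    rintro (v | F) h
    · exact h.1 rfl
    · exact h⟩

/-- The vertex set of the augmented graph of `F`: the vertices of `F` and the projection vertices
of the domains properly contained in `F`. -/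
def augVerts {V : Type*} (𝔉 : Set (Set V)) (F : Set V) : Set (V ⊕ Set V) :=
  {a | (∃ v ∈ F, a = Sum.inl v) ∨ ∃ H ∈ 𝔉, H ⊂ F ∧ a = Sum.inr H}

/-- The augmented graph of a domain `F ⊆ S`, computed in the triple given by the graph `S`, the
`S`-graph `W` and the domains contained in `S`. For `S = Set.univ` this is `CF`, and for
`S = F = Set.univ` it is `CX`. -/
def augGraph {V : Type*} (G : SimpleGraph V) (𝔉 : Set (Set V)) (S : Set V)
    (W : SimpleGraph (MaxClique G S)) (F : Set V) : SimpleGraph (augVerts 𝔉 F) :=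
  (edgeGraph G S W).induce (augVerts 𝔉 F)

/-- The projection part `PF`: the link of `F`, the projection vertices of the domains contained
in the link of `F` (including that of the link itself, if it is non-empty), and the
projection vertices of the non-maximal domains containing `F`. -/
def projPart {V : Type*} (G : SimpleGraph V) (𝔉 : Set (Set V)) (F : Set V) : Set (V ⊕ Set V) :=
  {a | (∃ v ∈ link G F, a = Sum.inl v) ∨
    (∃ H ∈ 𝔉, H ⊆ link G F ∧ a = Sum.inr H) ∨
    (∃ H ∈ 𝔉, H ≠ Set.univ ∧ F ⊆ H ∧ a = Sum.inr H)}

/-- The vertex set of the complement graph `Y_F`. -/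
def complVerts {V : Type*} (G : SimpleGraph V) (𝔉 : Set (Set V)) (F : Set V) :
    Set (V ⊕ Set V) :=
  augVerts 𝔉 Set.univ \ projPart G 𝔉 F

/-- The complement graph `Y_F`, an induced subgraph of `CX`. -/
def complGraph {V : Type*} (G : SimpleGraph V) (𝔉 : Set (Set V))
    (W : SimpleGraph (MaxClique G Set.univ)) (F : Set V) : SimpleGraph (complVerts G 𝔉 F) :=
  (edgeGraph G Set.univ W).induce (complVerts G 𝔉 F)

theorem complVerts_subset {V : Type*} (G : SimpleGraph V) (𝔉 : Set (Set V)) (F : Set V) :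
    complVerts G 𝔉 F ⊆ augVerts 𝔉 Set.univ :=
  Set.sdiff_subset

/-- `CF` is a subgraph of `Y_F`. -/
theorem augVerts_subset_complVerts {V : Type*} {G : SimpleGraph V} {𝔉 : Set (Set V)} {n : ℕ}
    (h : IsGraphFactorSystem G 𝔉 n) (F : Set V) : augVerts 𝔉 F ⊆ complVerts G 𝔉 F := by
  rintro a (⟨v, hv, rfl⟩ | ⟨H, hH, hHF, rfl⟩)
  · refine ⟨Or.inl ⟨v, trivial, rfl⟩, ?_⟩
    rintro (⟨w, hw, hvw⟩ | ⟨H, _, _, hh⟩ | ⟨H, _, _, _, hh⟩)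
    · cases hvw
      exact G.loopless.irrefl v (hw v hv)
    · cases hh
    · cases hh
  · refine ⟨Or.inr ⟨H, hH, lt_of_lt_of_le hHF (Set.subset_univ F), rfl⟩, ?_⟩
    rintro (⟨w, _, hh⟩ | ⟨K, _, hK, hh⟩ | ⟨K, _, _, hK, hh⟩)
    · cases hh
    · cases hh
      obtain ⟨v, hv⟩ := h.nonempty_of_mem H hH
      exact G.loopless.irrefl v (hK hv v (hHF.1 hv))
    · cases hh
      exact hHF.2 hK

/-! ### Combinatorial HHS with factor system -/

/-- The `δ`-hyperbolicity condition: every `CF` is `δ`-hyperbolic and its inclusion into `Y_F` is a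
`(δ, δ)`-quasi-isometric embedding. -/
def HyperbolicityCondition {V : Type*} {G : SimpleGraph V} {𝔉 : Set (Set V)} {n : ℕ}
    (h : IsGraphFactorSystem G 𝔉 n) (W : SimpleGraph (MaxClique G Set.univ)) (δ : ℝ) : Prop :=
  ∀ F ∈ 𝔉, IsHyperbolic (augGraph G 𝔉 Set.univ W F) δ ∧
    IsQIEmbedding (augGraph G 𝔉 Set.univ W F) (complGraph G 𝔉 W F) δ
      (Set.inclusion (augVerts_subset_complVerts h F))

/-- The hierarchy condition: every domain `F` carries an `F`-graph `WF F` such that, for all domains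
`F' ⊆ F`, the augmented graph of `F'` computed in `F` is `CF'`, and each (possibly empty) maximal
clique `x` in the part of the link of `F'` inside `F` induces a map of graphs from `WF F'` to `WF F`
(adjacent vertices have equal or adjacent images) that sends each maximal clique `w` of `F'` to
a maximal clique of `F` containing the join of `x` and `w`. -/
def HierarchyCondition {V : Type*} (G : SimpleGraph V) (𝔉 : Set (Set V))
    (W : SimpleGraph (MaxClique G Set.univ)) : Prop :=
  ∃ WF : (F : Set V) → SimpleGraph (MaxClique G F),
    ∀ F ∈ 𝔉, ∀ F' ∈ 𝔉, F' ⊆ F →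
      augGraph G 𝔉 F (WF F) F' = augGraph G 𝔉 Set.univ W F' ∧
      ∀ x : MaxClique G (link G F' ∩ F),
        ∃ φ : MaxClique G F' → MaxClique G F,
          (∀ w, x.1 ∪ w.1 ⊆ (φ w).1) ∧
          ∀ w w', (WF F').Adj w w' → φ w = φ w' ∨ (WF F).Adj (φ w) (φ w')

/-- `(X, W, 𝔉)` is an `(n, δ)`-CHHF (combinatorial HHS with factor system), where `X` is the
graph `G` and `W` is a graph on the maximal cliques of `G`. -/
structure IsCHHF {V : Type*} (G : SimpleGraph V) (W : SimpleGraph (MaxClique G Set.univ))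
    (𝔉 : Set (Set V)) (n : ℕ) (δ : ℝ) : Prop where
  factorSystem : IsGraphFactorSystem G 𝔉 n
  hyperbolicity : HyperbolicityCondition factorSystem W δ
  hierarchy : HierarchyCondition G 𝔉 W

/-- The coarse closest-point projection `p_F` from `Y_F` to the subsets of `CF`: the vertices `a` of
`CF` whose distance to `x` in `Y_F` is at most the distance from `x` to `CF` plus one. -/
noncomputable def closestProj {V : Type*} {G : SimpleGraph V} {𝔉 : Set (Set V)} {n : ℕ}
    (h : IsGraphFactorSystem G 𝔉 n) (W : SimpleGraph (MaxClique G Set.univ)) (F : Set V)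
    (x : complVerts G 𝔉 F) : Set (augVerts 𝔉 F) :=
  {a | (complGraph G 𝔉 W F).edist x (Set.inclusion (augVerts_subset_complVerts h F) a) ≤
    (⨅ z : augVerts 𝔉 F,
      (complGraph G 𝔉 W F).edist x (Set.inclusion (augVerts_subset_complVerts h F) z)) + 1}

end CHHF

/-! Let Z be `Y_F` with `b_F` put back. If Z is hyperbolic, with a constant depending only on `n`
and `δ`, then the theorem is a bounded geodesic image property at the single vertex `b_F`. A
geodesic of CX that misses `PF` is also a geodesic of Z that misses `b_F`. Call the last vertex
before `b_F` on a geodesic from `x` to `b_F` a gate of `x`. By `gate_near`, the gates of `x` and `y`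
are close off `b_F`, that is, in `Y_F`: in the slim triangle with vertices `x`, `b_F`, `y`, short
connecting paths that start far enough from `b_F` cannot run through it. Points of the closest-point
projection are close to gates (`gate_near_of_walk`), so `a` and `b` are close in `Y_F`, hence in
`CF` by the quasi-isometric embedding.

The work is the hyperbolicity of Z. First the link of `F` and the projection vertices of the domains
in it are deleted from CX. Remaining vertices next to the deleted part are close to `b_F` by paths
avoiding that part (`IsCHHF.near_hub`), so excursions into it can be rerouted and hyperbolicity
survives (`IsCHHF.hyp_core`). The same holds inside each augmented graph CH with `F ⊆ H`, and the
result is the core of `H`.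

Next the vertices `b_H` with `F ⊊ H` are deleted, those of largest rank first. The neighbours of
`b_H` lie in the core of `H`, which is hyperbolic and, once the domains above `H` are gone,
undistorted in the complement of `b_H`, because CH is quasi-isometrically embedded in `Y_H`.
Deleting such cone points preserves hyperbolicity (`ConeSystem.hyp_base`): replacing each passage of
a geodesic through a cone point by a geodesic of the core gives sets to which the guessing-geodesics
criterion `GuessFamily.slim` applies. -/

namespace CHHF

/-! ### Coarse distances -/

/-- The distance of `x` and `y` in `H` is at most `n`. -/
def Near {A : Type*} (H : SimpleGraph A) (n : ℕ) (x y : A) : Prop :=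
  ∃ p : H.Walk x y, p.length ≤ n

section Near

variable {A : Type*} {H H' : SimpleGraph A} {x y z : A} {m n : ℕ}

theorem Near.refl (H : SimpleGraph A) (n : ℕ) (x : A) : Near H n x x := ⟨.nil, by simp⟩

theorem Near.symm (h : Near H n x y) : Near H n y x := by
  obtain ⟨p, hp⟩ := h
  exact ⟨p.reverse, by simpa using hp⟩

theorem Near.trans (h : Near H m x y) (h' : Near H n y z) : Near H (m + n) x z := by
  obtain ⟨p, hp⟩ := h
  obtain ⟨q, hq⟩ := h'
  exact ⟨p.append q, by rw [SimpleGraph.Walk.length_append]; omega⟩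

theorem Near.mono (hmn : m ≤ n) (h : Near H m x y) : Near H n x y := by
  obtain ⟨p, hp⟩ := h
  exact ⟨p, hp.trans hmn⟩

theorem Near.mono_graph (hH : H ≤ H') (h : Near H n x y) : Near H' n x y := by
  obtain ⟨p, hp⟩ := h
  exact ⟨p.mapLe hH, by simpa using hp⟩

theorem Near.of_adj (h : H.Adj x y) : Near H 1 x y := ⟨.cons h .nil, by simp⟩

theorem Near.of_eq (h : x = y) : Near H n x y := h ▸ Near.refl H n x

theorem near_zero_iff : Near H 0 x y ↔ x = y := by
  refine ⟨fun ⟨p, hp⟩ ↦ SimpleGraph.Walk.eq_of_length_eq_zero (Nat.le_zero.1 hp), Near.of_eq⟩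

theorem Near.reachable (h : Near H n x y) : H.Reachable x y := ⟨h.choose⟩

theorem Near.dist_le (h : Near H n x y) : H.dist x y ≤ n :=
  (SimpleGraph.dist_le _).trans h.choose_spec

/-! ### Geodesics -/

theorem isGeodesic_iff {p : H.Walk x y} : IsGeodesic p ↔ ∀ q : H.Walk x y, p.length ≤ q.length := by
  refine ⟨fun h q ↦ h.trans_le (SimpleGraph.dist_le q), fun h ↦ ?_⟩
  obtain ⟨q, hq⟩ := SimpleGraph.Reachable.exists_walk_length_eq_dist ⟨p⟩
  exact le_antisymm (hq ▸ h q) (SimpleGraph.dist_le p)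

theorem IsGeodesic.length_le {p : H.Walk x y} (h : IsGeodesic p) (q : H.Walk x y) :
    p.length ≤ q.length := isGeodesic_iff.1 h q

theorem IsGeodesic.length_le_of_near {p : H.Walk x y} (h : IsGeodesic p) (hn : Near H n x y) :
    p.length ≤ n := (h.length_le _).trans hn.choose_spec

theorem exists_isGeodesic (h : H.Reachable x y) : ∃ p : H.Walk x y, IsGeodesic p :=
  h.exists_walk_length_eq_dist

theorem IsGeodesic.reverse {p : H.Walk x y} (h : IsGeodesic p) : IsGeodesic p.reverse := by
  rw [isGeodesic_iff] at *
  intro q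
  simpa using h q.reverse

theorem IsGeodesic.append_left {p : H.Walk x y} {q : H.Walk y z} (h : IsGeodesic (p.append q)) :
    IsGeodesic p := by
  rw [isGeodesic_iff] at *
  intro r
  have := h (r.append q)
  simp only [SimpleGraph.Walk.length_append] at this
  omega

theorem IsGeodesic.append_right {p : H.Walk x y} {q : H.Walk y z} (h : IsGeodesic (p.append q)) :
    IsGeodesic q := by
  rw [isGeodesic_iff] at *
  intro r
  have := h (p.append r)
  simp only [SimpleGraph.Walk.length_append] at this
  omega

theorem isGeodesic_of_adj (h : H.Adj x y) : IsGeodesic (.cons h .nil : H.Walk x y) := by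
  rw [isGeodesic_iff]
  intro q
  rcases Nat.eq_zero_or_pos q.length with h0 | h0
  · exact absurd (SimpleGraph.Walk.eq_of_length_eq_zero h0) h.ne
  · exact h0

theorem exists_subwalk (γ : H.Walk x y) {i j : ℕ} (hij : i ≤ j) :
    ∃ q : H.Walk (γ.getVert i) (γ.getVert j), q.length ≤ j - i ∧
      ∀ v ∈ q.support, v ∈ γ.support := by
  have e : (γ.drop i).getVert (j - i) = γ.getVert j := by
    rw [SimpleGraph.Walk.drop_getVert]; congr 1; omega
  refine ⟨((γ.drop i).take (j - i)).copy rfl e, ?_, ?_⟩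
  · simp [SimpleGraph.Walk.take_length]
  · intro v hv
    rw [SimpleGraph.Walk.support_copy, SimpleGraph.Walk.mem_support_iff_exists_getVert] at hv
    obtain ⟨k, rfl, -⟩ := hv
    rw [SimpleGraph.Walk.take_getVert, SimpleGraph.Walk.drop_getVert]
    exact SimpleGraph.Walk.getVert_mem_support _ _

theorem near_of_mem_support {p : H.Walk x y} {u v : A} (hu : u ∈ p.support) (hv : v ∈ p.support) :
    Near H p.length u v := by
  have key : ∀ i j, i ≤ j → j ≤ p.length → Near H p.length (p.getVert i) (p.getVert j) := by
    intro i j hij hj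
    obtain ⟨q, hq, -⟩ := exists_subwalk p hij
    exact ⟨q, by omega⟩
  obtain ⟨i, rfl, hi⟩ := SimpleGraph.Walk.mem_support_iff_exists_getVert.1 hu
  obtain ⟨j, rfl, hj⟩ := SimpleGraph.Walk.mem_support_iff_exists_getVert.1 hv
  rcases le_total i j with hij | hij
  · exact key i j hij hj
  · exact (key j i hij hi).symm

theorem IsGeodesic.sub_le_of_near {γ : H.Walk x y} (hγ : IsGeodesic γ) {i j : ℕ}
    (hj : j ≤ γ.length) (h : Near H n (γ.getVert i) (γ.getVert j)) : j ≤ i + n := by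
  obtain ⟨q, hq⟩ := h
  have := hγ.length_le (((γ.take i).append q).append (γ.drop j))
  simp only [SimpleGraph.Walk.length_append, SimpleGraph.Walk.take_length,
    SimpleGraph.Walk.drop_length] at this
  omega

theorem IsGeodesic.take {γ : H.Walk x y} (hγ : IsGeodesic γ) (i : ℕ) : IsGeodesic (γ.take i) := by
  rw [← γ.append_take_drop_eq i] at hγ
  exact hγ.append_left

theorem IsGeodesic.drop {γ : H.Walk x y} (hγ : IsGeodesic γ) (i : ℕ) : IsGeodesic (γ.drop i) := by
  rw [← γ.append_take_drop_eq i] at hγ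
  exact hγ.append_right

end Near

/-! ### Slim triangles and families of guessed geodesics -/

/-- Geodesic triangles of `H` are `δ`-slim. -/
def Slim {A : Type*} (H : SimpleGraph A) (δ : ℕ) : Prop :=
  ∀ (a b c : A) (p : H.Walk a b) (q : H.Walk b c) (r : H.Walk a c),
    IsGeodesic p → IsGeodesic q → IsGeodesic r →
      ∀ u ∈ p.support, ∃ v, (v ∈ q.support ∨ v ∈ r.support) ∧ Near H δ u v

theorem Slim.mono {A : Type*} {H : SimpleGraph A} {δ δ' : ℕ} (h : Slim H δ) (hδ : δ ≤ δ') :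
    Slim H δ' := by
  intro a b c p q r hp hq hr u hu
  obtain ⟨v, hv, hn⟩ := h a b c p q r hp hq hr u hu
  exact ⟨v, hv, hn.mono hδ⟩

/-- A family of coarsely connected sets `L x y`, for `x` and `y` in a connected component
`S` of `H`, whose triangles are `h`-slim. -/
structure GuessFamily {A : Type*} (H : SimpleGraph A) (S : Set A) (L : A → A → Set A) (h : ℕ) :
    Prop where
  closed : ∀ x ∈ S, ∀ y, H.Adj x y → y ∈ S
  conn : ∀ x ∈ S, ∀ y ∈ S, H.Reachable x y
  thin : ∀ x ∈ S, ∀ y ∈ S, ∀ z ∈ S, ∀ u ∈ L x y, ∃ v, (v ∈ L x z ∨ v ∈ L z y) ∧ Near H h u v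
  small : ∀ x ∈ S, ∀ y ∈ S, Near H 1 x y → ∀ u ∈ L x y, Near H h u x
  cut : ∀ x ∈ S, ∀ y ∈ S, ∀ P : A → Prop, P x → ¬ P y →
    ∃ u ∈ L x y, ∃ v ∈ L x y, P u ∧ ¬ P v ∧ Near H h u v
  right_mem : ∀ x ∈ S, ∀ y ∈ S, y ∈ L x y

namespace GuessFamily

variable {A : Type*} {H : SimpleGraph A} {S : Set A} {L : A → A → Set A} {h : ℕ}

theorem mem_of_mem_support (hL : GuessFamily H S L h) {x y : A} (hx : x ∈ S) (p : H.Walk x y) :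
    ∀ v ∈ p.support, v ∈ S := by
  induction p with
  | nil => simpa using hx
  | cons ha p ih =>
    intro v hv
    rw [SimpleGraph.Walk.support_cons, List.mem_cons] at hv
    rcases hv with rfl | hv
    · exact hx
    · exact ih (hL.closed _ hx _ ha) v hv

theorem near_walk (hL : GuessFamily H S L h) (k : ℕ) {x y : A} (hx : x ∈ S) (p : H.Walk x y)
    (hp : p.length ≤ 2 ^ k) {u : A} (hu : u ∈ L x y) :
    ∃ v ∈ p.support, Near H (h * (k + 1)) u v := by
  induction k generalizing x y u with
  | zero =>
    refine ⟨x, p.start_mem_support, ?_⟩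
    simpa using hL.small x hx y (hL.mem_of_mem_support hx p y p.end_mem_support)
      ⟨p, by simpa using hp⟩ u hu
  | succ k ih =>
    have hz := hL.mem_of_mem_support hx p _ (p.getVert_mem_support (2 ^ k))
    obtain ⟨w, hw, huw⟩ := hL.thin x hx y (hL.mem_of_mem_support hx p y p.end_mem_support)
      (p.getVert (2 ^ k)) hz u hu
    have hsup : ∀ v, v ∈ (p.take (2 ^ k)).support ∨ v ∈ (p.drop (2 ^ k)).support →
        v ∈ p.support := by
      intro v hv
      rw [← p.append_take_drop_eq (2 ^ k)]
      exact (SimpleGraph.Walk.mem_support_append_iff _ _).2 hv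
    rcases hw with hw | hw
    · obtain ⟨v, hv, hn⟩ := ih hx (p.take (2 ^ k))
        (by rw [SimpleGraph.Walk.take_length]; omega) hw
      exact ⟨v, hsup v (Or.inl hv), (huw.trans hn).mono (le_of_eq (by ring))⟩
    · obtain ⟨v, hv, hn⟩ := ih hz (p.drop (2 ^ k))
        (by rw [SimpleGraph.Walk.drop_length, pow_succ] at *; omega) hw
      exact ⟨v, hsup v (Or.inr hv), (huw.trans hn).mono (le_of_eq (by ring))⟩

theorem exists_log_bound (h t : ℕ) (ht : 16 * (h + 1) ^ 2 ≤ t) :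
    ∃ k, t + 2 * h + 2 ≤ 2 ^ k ∧ h * (k + 3) ≤ t := by
  have hdiv : t < 2 * (h + 1) * (t / (2 * (h + 1)) + 1) := by
    have := Nat.lt_div_mul_add (a := t) (b := 2 * (h + 1)) (by omega)
    nlinarith
  have hdiv' : 2 * (h + 1) * (t / (2 * (h + 1))) ≤ t := Nat.mul_div_le _ _
  have hk8 : 8 * (h + 1) ≤ t / (2 * (h + 1)) := by
    rw [Nat.le_div_iff_mul_le (by omega)]
    nlinarith
  -- An exponent linear in `t`, with slope small enough for the second bound. Exponential growth
  -- then gives the first one.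
  refine ⟨t / (2 * (h + 1)), ?_, ?_⟩
  · generalize t / (2 * (h + 1)) = k at *
    have h1 : k / 2 + 1 ≤ 2 ^ (k / 2) := Nat.lt_two_pow_self
    have h2 : 2 ^ (k / 2) * 2 ^ (k / 2) ≤ 2 ^ k := by
      rw [← pow_add]
      exact Nat.pow_le_pow_right (by omega) (by omega)
    have h3 : (k / 2 + 1) * (k / 2 + 1) ≤ 2 ^ k := (Nat.mul_le_mul h1 h1).trans h2
    have h4 : 4 * (h + 1) ≤ k / 2 := by omega
    have h5 : k ≤ 2 * (k / 2) + 1 := by omega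
    generalize k / 2 = a at *
    nlinarith
  · generalize t / (2 * (h + 1)) = k at *
    nlinarith

/-- Self-improvement of the distance bound. If `u` is far from `γ`, then by `near_walk` it is far
from the guessed sets of all short pieces of `γ`. Cutting out such pieces leaves `u` near the
guessed sets of two end pieces of `γ` separated by a long gap. The weaker bound on these end pieces
gives a shortcut across the gap. -/
theorem bound_step (hL : GuessFamily H S L h) {m t : ℕ} (ht : 16 * (h + 1) ^ 2 ≤ t)
    (hD : ∀ x ∈ S, ∀ (y : A) (γ : H.Walk x y), IsGeodesic γ → γ.length ≤ m →
      ∀ u ∈ L x y, ∃ v ∈ γ.support, Near H (t + 1) u v) :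
    ∀ x ∈ S, ∀ (y : A) (γ : H.Walk x y), IsGeodesic γ → γ.length ≤ m →
      ∀ u ∈ L x y, ∃ v ∈ γ.support, Near H t u v := by
  classical
  intro x hx y γ hγ hm u hu
  by_contra hcon
  have hfar : ∀ v ∈ γ.support, ∀ N ≤ t, ¬ Near H N u v :=
    fun v hv N hN hn ↦ hcon ⟨v, hv, hn.mono hN⟩
  obtain ⟨k, hk, hkt⟩ := exists_log_bound h t ht
  have h3 : h * 3 ≤ t := (Nat.mul_le_mul_left h (by omega)).trans hkt
  have hS : ∀ i, γ.getVert i ∈ S :=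
    fun i ↦ hL.mem_of_mem_support hx γ _ (γ.getVert_mem_support i)
  have hy : y ∈ S := hL.mem_of_mem_support hx γ _ γ.end_mem_support
  -- The final gap `2 * r - 1 = 2 * t + 4 * h + 3` exceeds the shortcut of length `2 * (2 * h + t +
  -- 1)` by one.
  set r := t + 2 * h + 2 with hr
  -- At the least such `s`, thinness at the vertex before it forces `u` to be near the guessed set
  -- of the other part.
  have hP : ∃ s, ∃ w ∈ L x (γ.getVert s), Near H h u w :=
    ⟨γ.length, u, by simpa using hu, Near.refl H h u⟩
  obtain ⟨w₂, hw₂, hn₂⟩ := Nat.find_spec hP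
  have hmin : ∀ s < Nat.find hP, ¬ ∃ w ∈ L x (γ.getVert s), Near H h u w :=
    fun s hs ↦ Nat.find_min hP hs
  set s := Nat.find hP with hs
  clear_value s
  have hs0 : s ≠ 0 := by
    rintro rfl
    rw [SimpleGraph.Walk.getVert_zero] at hw₂
    exact hfar x γ.start_mem_support (h + h) (by omega)
      (hn₂.trans (hL.small x hx x hx (Near.refl H 1 x) w₂ hw₂))
  obtain ⟨w₁, hw₁, hn₁⟩ : ∃ w ∈ L (γ.getVert (s - 1)) y, Near H h u w := by
    obtain ⟨w, hw | hw, hn⟩ := hL.thin x hx y hy _ (hS (s - 1)) u hu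
    · exact absurd ⟨w, hw, hn⟩ (hmin (s - 1) (by omega))
    · exact ⟨w, hw, hn⟩
  have hlog : ∀ i j, i ≤ j → j ≤ i + r → ∀ w ∈ L (γ.getVert i) (γ.getVert j),
      ¬ Near H (h + h) u w := by
    intro i j hij hjr w hw hn
    obtain ⟨q, hq, hqs⟩ := exists_subwalk γ hij
    obtain ⟨v, hv, hnv⟩ := hL.near_walk k (hS i) q (by omega) hw
    exact hfar v (hqs v hv) _ (le_trans (le_of_eq (by ring)) hkt) (hn.trans hnv)
  obtain ⟨w₄, hw₄, hn₄⟩ : ∃ w ∈ L x (γ.getVert (s - r)), Near H (h + h) u w := by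
    obtain ⟨w, hw | hw, hn⟩ := hL.thin x hx _ (hS s) _ (hS (s - r)) w₂ hw₂
    · exact ⟨w, hw, hn₂.trans hn⟩
    · exact absurd (hn₂.trans hn) (hlog (s - r) s (by omega) (by omega) w hw)
  obtain ⟨w₃, hw₃, hn₃⟩ : ∃ w ∈ L (γ.getVert (s - 1 + r)) y, Near H (h + h) u w := by
    obtain ⟨w, hw | hw, hn⟩ := hL.thin _ (hS (s - 1)) y hy _ (hS (s - 1 + r)) w₁ hw₁
    · exact absurd (hn₁.trans hn) (hlog (s - 1) (s - 1 + r) (by omega) (by omega) w hw)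
    · exact ⟨w, hw, hn₁.trans hn⟩
  have hsr : r ≤ s := by
    by_contra hlt
    rw [show s - r = 0 by omega, SimpleGraph.Walk.getVert_zero] at hw₄
    exact hfar x γ.start_mem_support (h + h + h) (by omega)
      (hn₄.trans (hL.small x hx x hx (Near.refl H 1 x) w₄ hw₄))
  have hsr' : s - 1 + r ≤ γ.length := by
    by_contra hlt
    rw [SimpleGraph.Walk.getVert_of_length_le γ (by omega)] at hw₃
    exact hfar y γ.end_mem_support (h + h + h) (by omega)
      (hn₃.trans (hL.small y hy y hy (Near.refl H 1 y) w₃ hw₃))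
  obtain ⟨v₄, hv₄, hd₄⟩ := hD x hx _ (γ.take (s - r)) (hγ.take _)
    (by rw [SimpleGraph.Walk.take_length]; omega) w₄ hw₄
  obtain ⟨v₃, hv₃, hd₃⟩ := hD _ (hS (s - 1 + r)) y (γ.drop (s - 1 + r)) (hγ.drop _)
    (by rw [SimpleGraph.Walk.drop_length]; omega) w₃ hw₃
  obtain ⟨i, rfl, hi⟩ := SimpleGraph.Walk.mem_support_iff_exists_getVert.1 hv₄
  obtain ⟨j, rfl, hj⟩ := SimpleGraph.Walk.mem_support_iff_exists_getVert.1 hv₃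
  rw [SimpleGraph.Walk.take_getVert] at hd₄
  rw [SimpleGraph.Walk.drop_getVert] at hd₃
  rw [SimpleGraph.Walk.take_length] at hi
  rw [SimpleGraph.Walk.drop_length] at hj
  have := hγ.sub_le_of_near (by omega) ((hn₄.trans hd₄).symm.trans (hn₃.trans hd₃))
  omega

/-- `near_walk` supplies a bound that depends on the length of `γ`; `bound_step` lowers it one unit
at a time to a uniform one. -/
theorem near_geodesic (hL : GuessFamily H S L h) {x y : A} (hx : x ∈ S) (γ : H.Walk x y)
    (hγ : IsGeodesic γ) {u : A} (hu : u ∈ L x y) :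
    ∃ v ∈ γ.support, Near H (16 * (h + 1) ^ 2) u v := by
  have hall : ∀ d, (∀ x ∈ S, ∀ (y : A) (γ' : H.Walk x y), IsGeodesic γ' → γ'.length ≤ γ.length →
      ∀ u ∈ L x y, ∃ v ∈ γ'.support, Near H (16 * (h + 1) ^ 2 + d) u v) →
      ∀ x ∈ S, ∀ (y : A) (γ' : H.Walk x y), IsGeodesic γ' → γ'.length ≤ γ.length →
      ∀ u ∈ L x y, ∃ v ∈ γ'.support, Near H (16 * (h + 1) ^ 2) u v := by
    intro d
    induction d with
    | zero => exact fun hd ↦ hd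
    | succ d ih => exact fun hd ↦ ih (hL.bound_step (by omega) hd)
  refine hall (h * (γ.length + 1)) ?_ x hx y γ hγ le_rfl u hu
  intro x hx y γ' _ hlen u hu
  obtain ⟨v, hv, hn⟩ := hL.near_walk γ.length hx γ'
    (hlen.trans Nat.lt_two_pow_self.le) hu
  exact ⟨v, hv, hn.mono (by omega)⟩

/-- Cut the guessed set into the points near the part of `γ` up to `u` and the others. Two
neighbouring points across the cut are near points of `γ` on both sides of `u`, and those are at
most `2 * D + h` apart. -/
theorem geodesic_near (hL : GuessFamily H S L h) {x y : A} (hx : x ∈ S) (γ : H.Walk x y)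
    (hγ : IsGeodesic γ) {u : A} (hu : u ∈ γ.support) :
    ∃ v ∈ L x y, Near H (48 * (h + 1) ^ 2 + h) u v := by
  set D := 16 * (h + 1) ^ 2 with hDdef
  have hy : y ∈ S := hL.mem_of_mem_support hx γ _ γ.end_mem_support
  obtain ⟨s, rfl, hs⟩ := SimpleGraph.Walk.mem_support_iff_exists_getVert.1 hu
  by_cases hPy : ∃ i ≤ s, Near H D y (γ.getVert i)
  · obtain ⟨i, his, hi⟩ := hPy
    refine ⟨y, hL.right_mem x hx y hy, ?_⟩
    have h1 := hγ.sub_le_of_near (i := i) le_rfl (by simpa using hi.symm)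
    obtain ⟨q, hq, -⟩ := exists_subwalk γ hs
    have : Near H (γ.length - s) (γ.getVert s) (γ.getVert γ.length) := ⟨q, hq⟩
    rw [SimpleGraph.Walk.getVert_length] at this
    exact this.mono (by omega)
  · obtain ⟨w, hw, w', hw', ⟨i, his, hi⟩, hnot, hww'⟩ := hL.cut x hx y hy
      (fun w ↦ ∃ i ≤ s, Near H D w (γ.getVert i))
      ⟨0, by omega, Near.of_eq (by simp)⟩ hPy
    obtain ⟨v, hv, hn⟩ := hL.near_geodesic hx γ hγ hw'
    obtain ⟨j, rfl, hj⟩ := SimpleGraph.Walk.mem_support_iff_exists_getVert.1 hv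
    have hjs : s < j := by
      by_contra hle
      exact hnot ⟨j, by omega, hn⟩
    have h1 := hγ.sub_le_of_near hj ((hi.symm.trans hww').trans hn)
    obtain ⟨q, hq, -⟩ := exists_subwalk γ his
    have h2 : Near H (s - i) (γ.getVert i) (γ.getVert s) := ⟨q, hq⟩
    exact ⟨w, hw, (hi.trans h2).symm.mono (by omega)⟩

theorem slim (hL : GuessFamily H S L h) (hS : ∀ x y, H.Adj x y → x ∈ S) :
    Slim H (64 * (h + 1) ^ 2 + 2 * h) := by
  intro a b c p q r hp hq hr u hu
  by_cases ha : a ∈ S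
  · have hb : b ∈ S := hL.mem_of_mem_support ha p _ p.end_mem_support
    have hc : c ∈ S := hL.mem_of_mem_support ha r _ r.end_mem_support
    obtain ⟨v, hv, huv⟩ := hL.geodesic_near ha p hp hu
    obtain ⟨w, hw | hw, hvw⟩ := hL.thin a ha b hb c hc v hv
    · obtain ⟨z, hz, hwz⟩ := hL.near_geodesic ha r hr hw
      exact ⟨z, Or.inr hz, ((huv.trans hvw).trans hwz).mono (by omega)⟩
    · obtain ⟨z, hz, hwz⟩ := hL.near_geodesic hc q.reverse hq.reverse hw
      exact ⟨z, Or.inl (by simpa using hz), ((huv.trans hvw).trans hwz).mono (by omega)⟩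
  · cases p with
    | nil =>
      refine ⟨u, Or.inr ?_, Near.refl _ _ _⟩
      simp only [SimpleGraph.Walk.support_nil, List.mem_singleton] at hu
      rw [hu]
      exact r.start_mem_support
    | cons hab p => exact absurd (hS _ _ hab) ha

end GuessFamily

/-! ### Restrictions of a graph to a set of vertices -/

/-- The graph on all of `A` whose edges are the edges of `E` with both ends in `S`. -/
def restr {A : Type*} (E : SimpleGraph A) (S : Set A) : SimpleGraph A where
  Adj x y := E.Adj x y ∧ x ∈ S ∧ y ∈ S
  symm := ⟨fun _ _ h ↦ ⟨h.1.symm, h.2.2, h.2.1⟩⟩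
  loopless := ⟨fun _ h ↦ h.1.ne rfl⟩

section restr

variable {A : Type*} {E : SimpleGraph A} {S S' : Set A} {x y : A}

theorem restr_mono (h : S ⊆ S') : restr E S ≤ restr E S' :=
  fun _ _ hxy ↦ ⟨hxy.1, h hxy.2.1, h hxy.2.2⟩

theorem restr_restr_compl (E : SimpleGraph A) (S : Set A) (c : A) :
    restr (restr E S) {c}ᶜ = restr E (S \ {c}) := by
  ext x y
  simp only [restr, Set.mem_compl_iff, Set.mem_singleton_iff, Set.mem_sdiff]
  tauto

theorem mem_of_mem_support_restr (hx : x ∈ S) (p : (restr E S).Walk x y) :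
    ∀ v ∈ p.support, v ∈ S := by
  induction p with
  | nil => simpa using hx
  | cons h p ih =>
    intro v hv
    rw [SimpleGraph.Walk.support_cons, List.mem_cons] at hv
    rcases hv with rfl | hv
    · exact hx
    · exact ih h.2.2 v hv

theorem near_restr_of_walk (p : E.Walk x y) (hp : ∀ v ∈ p.support, v ∈ S) :
    Near (restr E S) p.length x y := by
  induction p with
  | nil => exact Near.refl _ _ _
  | cons h p ih =>
    have h1 := ih fun v hv ↦ hp v (by simp [hv])
    rw [SimpleGraph.Walk.length_cons, add_comm]
    exact (Near.of_adj (H := restr E S) ⟨h, hp _ (by simp), hp _ (by simp)⟩).trans h1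

end restr

/-- The restriction of `E` to `S` is connected and its geodesic triangles are `δ`-slim. -/
structure Hyp {A : Type*} (E : SimpleGraph A) (S : Set A) (δ : ℕ) : Prop where
  conn : ∀ x ∈ S, ∀ y ∈ S, (restr E S).Reachable x y
  slim : Slim (restr E S) δ

theorem Hyp.mono {A : Type*} {E : SimpleGraph A} {S : Set A} {δ δ' : ℕ} (h : Hyp E S δ)
    (hδ : δ ≤ δ') : Hyp E S δ' := ⟨h.conn, h.slim.mono hδ⟩

theorem GuessFamily.hyp {A : Type*} {E : SimpleGraph A} {S : Set A} {L : A → A → Set A} {h : ℕ}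
    (hL : GuessFamily (restr E S) S L h) : Hyp E S (64 * (h + 1) ^ 2 + 2 * h) :=
  ⟨hL.conn, hL.slim fun _ _ h ↦ h.2.1⟩

theorem exists_adj_of_walk {A : Type*} {H : SimpleGraph A} {x y : A} (p : H.Walk x y)
    (P : A → Prop) (hx : P x) (hy : ¬ P y) :
    ∃ u ∈ p.support, ∃ v ∈ p.support, H.Adj u v ∧ P u ∧ ¬ P v := by
  obtain ⟨d, hd, h1, h2⟩ := p.exists_boundary_dart {v | P v} hx hy
  exact ⟨d.fst, p.dart_fst_mem_support_of_mem_darts hd, d.snd,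
    p.dart_snd_mem_support_of_mem_darts hd, d.adj, h1, h2⟩

/-- Hyperbolicity passes to coarsely dense undistorted sets of vertices. -/
theorem Hyp.of_dense {A : Type*} {E : SimpleGraph A} {S₀ S₁ : Set A} {δ N : ℕ}
    (hS : Hyp E S₀ δ) (hsub : S₁ ⊆ S₀)
    (hdense : ∀ v ∈ S₀, ∃ w ∈ S₁, Near (restr E S₀) N v w)
    (hqi : ∀ m, ∀ x ∈ S₁, ∀ y ∈ S₁, Near (restr E S₀) m x y → Near (restr E S₁) (N * m) x y) :
    Hyp E S₁ (64 * (N * (2 * N + δ + 1) + 1) ^ 2 + 2 * (N * (2 * N + δ + 1))) := by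
  -- Guessed sets: the points of `S₁` within `N` of geodesics of the larger graph. Every jump needed
  -- below has length at most `2 * N + δ + 1` there, and `hqi` multiplies it by `N`.
  refine GuessFamily.hyp (L := fun x y ↦ {z | z ∈ S₁ ∧ ∃ γ : (restr E S₀).Walk x y,
    IsGeodesic γ ∧ ∃ p ∈ γ.support, Near (restr E S₀) N z p}) ?_
  have hqi' : ∀ m ≤ 2 * N + δ + 1, ∀ x ∈ S₁, ∀ y ∈ S₁, Near (restr E S₀) m x y →
      Near (restr E S₁) (N * (2 * N + δ + 1)) x y :=
    fun m hm x hx y hy h ↦ (hqi m x hx y hy h).mono (Nat.mul_le_mul_left N hm)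
  refine ⟨fun x _ y h ↦ h.2.2, ?_, ?_, ?_, ?_, ?_⟩
  · intro x hx y hy
    obtain ⟨p⟩ := hS.conn x (hsub hx) y (hsub hy)
    exact (hqi p.length x hx y hy ⟨p, le_rfl⟩).reachable
  · rintro x hx y hy w hw z ⟨hz, γ, hγ, p, hp, hzp⟩
    obtain ⟨γ₁, hγ₁⟩ := exists_isGeodesic (hS.conn x (hsub hx) w (hsub hw))
    obtain ⟨γ₂, hγ₂⟩ := exists_isGeodesic (hS.conn w (hsub hw) y (hsub hy))
    obtain ⟨v, hv, hpv⟩ := hS.slim x y w γ γ₂.reverse γ₁ hγ hγ₂.reverse hγ₁ p hp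
    have hv₀ : v ∈ S₀ := by
      rcases hv with hv | hv
      · exact mem_of_mem_support_restr (hsub hw) γ₂ v (by simpa using hv)
      · exact mem_of_mem_support_restr (hsub hx) γ₁ v hv
    obtain ⟨u, hu, hvu⟩ := hdense v hv₀
    refine ⟨u, ?_, hqi' _ (by omega) z hz u hu ((hzp.trans hpv).trans hvu)⟩
    rcases hv with hv | hv
    · exact Or.inr ⟨hu, γ₂, hγ₂, v, by simpa using hv, hvu.symm⟩
    · exact Or.inl ⟨hu, γ₁, hγ₁, v, hv, hvu.symm⟩
  · rintro x hx y hy hxy z ⟨hz, γ, hγ, p, hp, hzp⟩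
    have h1 := hγ.length_le_of_near (hxy.mono_graph (restr_mono hsub))
    exact hqi' (N + 1) (by omega) z hz x hx
      (hzp.trans ((near_of_mem_support hp γ.start_mem_support).mono h1))
  · intro x hx y hy P hPx hPy
    obtain ⟨γ, hγ⟩ := exists_isGeodesic (hS.conn x (hsub hx) y (hsub hy))
    by_cases hQ : ∃ z ∈ S₁, P z ∧ Near (restr E S₀) N z y
    · obtain ⟨z, hz, hPz, hzy⟩ := hQ
      exact ⟨z, ⟨hz, γ, hγ, y, γ.end_mem_support, hzy⟩, y,
        ⟨hy, γ, hγ, y, γ.end_mem_support, Near.refl _ _ _⟩, hPz, hPy,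
        hqi' N (by omega) z hz y hy hzy⟩
    · obtain ⟨u, hu, v, hv, huv, ⟨z, hz, hPz, hzu⟩, hnv⟩ := exists_adj_of_walk γ
        (fun v ↦ ∃ z ∈ S₁, P z ∧ Near (restr E S₀) N z v) ⟨x, hx, hPx, Near.refl _ _ _⟩ hQ
      obtain ⟨w, hw, hvw⟩ := hdense v (mem_of_mem_support_restr (hsub hx) γ v hv)
      refine ⟨z, ⟨hz, γ, hγ, u, hu, hzu⟩, w, ⟨hw, γ, hγ, v, hv, hvw.symm⟩, hPz,
        fun hPw ↦ hnv ⟨w, hw, hPw, hvw.symm⟩, ?_⟩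
      exact hqi' (N + 1 + N) (by omega) z hz w hw ((hzu.trans (Near.of_adj huv)).trans hvw)
  · intro x hx y hy
    obtain ⟨γ, hγ⟩ := exists_isGeodesic (hS.conn x (hsub hx) y (hsub hy))
    exact ⟨hy, γ, hγ, y, γ.end_mem_support, Near.refl _ _ _⟩

/-! ### Bounded geodesic images at a vertex -/

/-- The vertex `a` is the last one before `c` on some geodesic from `x` to `c`. -/
def IsGate {A : Type*} (Z : SimpleGraph A) (c x a : A) : Prop :=
  ∃ (q : Z.Walk x a) (h : Z.Adj a c), IsGeodesic (q.concat h)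

section IsGate

variable {A : Type*} {Z : SimpleGraph A} {a b c x y : A} {δ n : ℕ}

theorem notMem_support_of_isGeodesic_concat {q : Z.Walk x a} {h : Z.Adj a c}
    (hq : IsGeodesic (q.concat h)) : c ∉ q.support := by
  intro hc
  obtain ⟨q₁, q₂, rfl⟩ := SimpleGraph.Walk.mem_support_iff_exists_append.1 hc
  have := hq.length_le q₁
  simp only [SimpleGraph.Walk.length_concat, SimpleGraph.Walk.length_append] at this
  omega

theorem isGate_self (h : Z.Adj a c) : IsGate Z c a a := ⟨.nil, h, isGeodesic_of_adj h⟩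

theorem exists_concat_of_ne (p : Z.Walk x c) (hx : x ≠ c) :
    ∃ (a : A) (q : Z.Walk x a) (h : Z.Adj a c), p = q.concat h := by
  have hn : ¬ p.Nil := SimpleGraph.Walk.not_nil_of_ne hx
  exact ⟨_, p.dropLast, p.adj_penultimate hn, (p.concat_dropLast (p.adj_penultimate hn)).symm⟩

theorem exists_isGate (h : Z.Reachable x c) (hx : x ≠ c) : ∃ a, IsGate Z c x a := by
  obtain ⟨p, hp⟩ := exists_isGeodesic h
  obtain ⟨a, q, ha, rfl⟩ := exists_concat_of_ne p hx
  exact ⟨a, q, ha, hp⟩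

theorem Near.off (h : Near Z n x y) (hc : ¬ Near Z n x c) : Near (restr Z {c}ᶜ) n x y := by
  obtain ⟨p, hp⟩ := h
  refine (near_restr_of_walk p ?_).mono hp
  rintro v hv rfl
  exact hc ((near_of_mem_support p.start_mem_support hv).mono hp)

theorem near_off_of_mem {p : Z.Walk x y} (hp : c ∉ p.support) :
    Near (restr Z {c}ᶜ) p.length x y :=
  near_restr_of_walk p fun _ hv h ↦ hp (Set.mem_singleton_iff.1 h ▸ hv)

/-- Take `u` on the geodesic to `c`, at distance `δ + 1` before `a`. Slimness joins it to `γ` or to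
the geodesic from `y` to `c` by a path too short to reach `c`. In the second case that geodesic is
followed to `b`; it is met within `2 * δ + 2` of `c`, so little of it is left. -/
theorem gate_near_aux (hZ : Slim Z δ) {γ : Z.Walk x y} (hγ : IsGeodesic γ)
    (ha : IsGate Z c x a) (hb : IsGate Z c y b) :
    (∃ g ∈ γ.support, Near (restr Z {c}ᶜ) (2 * δ + 1) a g) ∨
      Near (restr Z {c}ᶜ) (4 * δ + 2) a b := by
  obtain ⟨q, h, hq⟩ := ha
  obtain ⟨q', h', hq'⟩ := hb
  have hcq := notMem_support_of_isGeodesic_concat hq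
  have hcq' := notMem_support_of_isGeodesic_concat hq'
  by_cases hlen : q.length ≤ 2 * δ + 1
  · exact Or.inl ⟨x, γ.start_mem_support, (near_off_of_mem hcq).symm.mono hlen⟩
  · obtain ⟨u, q₁, q₂, rfl, hq₂⟩ : ∃ (u : A) (q₁ : Z.Walk x u) (q₂ : Z.Walk u a),
        q = q₁.append q₂ ∧ q₂.length = δ + 1 :=
      ⟨_, q.take (q.length - (δ + 1)), q.drop (q.length - (δ + 1)),
        (q.append_take_drop_eq _).symm, by rw [SimpleGraph.Walk.drop_length]; omega⟩
    rw [SimpleGraph.Walk.mem_support_append_iff, not_or] at hcq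
    have huc : ¬ Near Z (δ + 1) u c := by
      rintro ⟨s, hs⟩
      have := hq.length_le (q₁.append s)
      simp only [SimpleGraph.Walk.length_append, SimpleGraph.Walk.length_concat] at this
      omega
    have hua : Near (restr Z {c}ᶜ) (δ + 1) u a := hq₂ ▸ near_off_of_mem hcq.2
    obtain ⟨v, hv, huv⟩ := hZ x c y _ _ _ hq hq'.reverse hγ u
      (by simp [SimpleGraph.Walk.concat_eq_append, SimpleGraph.Walk.mem_support_append_iff])
    have huv' : Near (restr Z {c}ᶜ) δ u v := huv.off fun hn ↦ huc (hn.mono (by omega))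
    rcases hv with hv | hv
    · right
      rw [SimpleGraph.Walk.support_reverse, List.mem_reverse,
        SimpleGraph.Walk.support_concat, List.mem_append] at hv
      have hv' : v ∈ q'.support := by
        rcases hv with hv | hv
        · exact hv
        · rw [List.mem_singleton] at hv
          subst hv
          exact absurd (huv.mono (by omega)) huc
      obtain ⟨q₃, q₄, rfl⟩ := SimpleGraph.Walk.mem_support_iff_exists_append.1 hv'
      rw [SimpleGraph.Walk.mem_support_append_iff, not_or] at hcq'
      have hvc : Near Z (δ + (δ + 1 + 1)) v c :=
        huv.symm.trans (Near.trans ⟨q₂, hq₂.le⟩ (Near.of_adj h))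
      obtain ⟨s, hs⟩ := hvc
      have := hq'.length_le (q₃.append s)
      simp only [SimpleGraph.Walk.length_append, SimpleGraph.Walk.length_concat] at this
      exact ((hua.symm.trans huv').trans (near_off_of_mem hcq'.2)).mono (by omega)
    · exact Or.inl ⟨v, hv, (hua.symm.trans huv').mono (by omega)⟩

theorem IsGeodesic.exists_subwalk_of_near {γ : Z.Walk x y} (hγ : IsGeodesic γ) {u v : A}
    (hu : u ∈ γ.support) (hv : v ∈ γ.support) (h : Near Z n u v) :
    ∃ q : Z.Walk u v, q.length ≤ n ∧ ∀ w ∈ q.support, w ∈ γ.support := by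
  obtain ⟨i, rfl, hi⟩ := SimpleGraph.Walk.mem_support_iff_exists_getVert.1 hu
  obtain ⟨j, rfl, hj⟩ := SimpleGraph.Walk.mem_support_iff_exists_getVert.1 hv
  rcases le_total i j with hij | hij
  · obtain ⟨q, hq, hqs⟩ := exists_subwalk γ hij
    have := hγ.sub_le_of_near hj h
    exact ⟨q, by omega, hqs⟩
  · obtain ⟨q, hq, hqs⟩ := exists_subwalk γ hij
    have := hγ.sub_le_of_near hi h.symm
    exact ⟨q.reverse, by rw [SimpleGraph.Walk.length_reverse]; omega,
      fun w hw ↦ hqs w (by simpa using hw)⟩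

/-- A geodesic avoiding `c` joins vertices whose gates at `c` are close off `c`. -/
theorem gate_near (hZ : Slim Z δ) {γ : Z.Walk x y} (hγ : IsGeodesic γ) (hc : c ∉ γ.support)
    (ha : IsGate Z c x a) (hb : IsGate Z c y b) : Near (restr Z {c}ᶜ) (8 * δ + 6) a b := by
  have hle : restr Z {c}ᶜ ≤ Z := fun _ _ h ↦ h.1
  -- If both gates are near `γ`, the detour through `c` bounds the distance of the two points of `γ`
  -- by `4 * δ + 4`. The piece of `γ` between them avoids `c`.
  rcases gate_near_aux hZ hγ ha hb with ⟨g, hg, hag⟩ | h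
  · rcases gate_near_aux hZ hγ.reverse hb ha with ⟨g', hg', hbg⟩ | h
    · rw [SimpleGraph.Walk.support_reverse, List.mem_reverse] at hg'
      obtain ⟨-, h1, -⟩ := ha
      obtain ⟨-, h2, -⟩ := hb
      have h3 : Near Z (2 * δ + 1 + (1 + 1) + (2 * δ + 1)) g g' :=
        ((hag.mono_graph hle).symm.trans ((Near.of_adj h1).trans (Near.of_adj h2.symm))).trans
          (hbg.mono_graph hle)
      obtain ⟨q, hq, hqs⟩ := hγ.exists_subwalk_of_near hg hg' h3
      have h4 := (near_off_of_mem (c := c) (p := q) fun h ↦ hc (hqs c h)).mono hq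
      exact ((hag.trans h4).trans hbg.symm).mono (by omega)
    · exact h.symm.mono (by omega)
  · exact h.mono (by omega)

/-- The end of an almost shortest walk towards `c` is close to a gate at `c`. -/
theorem gate_near_of_walk (hZ : Slim Z δ) (η : Z.Walk x a) (hη : c ∉ η.support)
    (hlen : ∀ p : Z.Walk x c, η.length ≤ p.length) (ha : Near Z 2 a c) (hb : IsGate Z c x b) :
    Near (restr Z {c}ᶜ) (8 * δ + 9) b a := by
  -- Without its last edge, a nontrivial `η` is shorter than any walk from `x` to `c`, so a geodesic
  -- with the ends of `η₁` cannot meet `c`.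
  obtain ⟨u, η₁, η₂, rfl, hη₂, hη₁⟩ : ∃ (u : A) (η₁ : Z.Walk x u) (η₂ : Z.Walk u a),
      η = η₁.append η₂ ∧ η₂.length ≤ 1 ∧ (η₁.length = 0 ∨ η₁.length < η.length) :=
    ⟨_, η.take (η.length - 1), η.drop (η.length - 1), (η.append_take_drop_eq _).symm,
      by rw [SimpleGraph.Walk.drop_length]; omega,
      by rw [SimpleGraph.Walk.take_length]; omega⟩
  rw [SimpleGraph.Walk.mem_support_append_iff, not_or] at hη
  have huc : u ≠ c := fun h ↦ hη.1 (h ▸ η₁.end_mem_support)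
  obtain ⟨σ, hσ⟩ := exists_isGeodesic (H := Z) ⟨η₁⟩
  have hσ₁ := hσ.length_le η₁
  have hcσ : c ∉ σ.support := by
    intro hc
    rcases hη₁ with h0 | hlt
    · have hσ0 : σ.length = 0 := by omega
      have hxu := SimpleGraph.Walk.eq_of_length_eq_zero hσ0
      subst hxu
      have := near_of_mem_support hc σ.end_mem_support
      rw [hσ0, near_zero_iff] at this
      exact huc this.symm
    · obtain ⟨σ₁, σ₂, rfl⟩ := SimpleGraph.Walk.mem_support_iff_exists_append.1 hc
      have := hlen σ₁
      rw [SimpleGraph.Walk.length_append] at hσ₁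
      omega
  have hua : Near Z 1 u a := ⟨η₂, hη₂⟩
  obtain ⟨w, hw⟩ := exists_isGate (hua.trans ha).reachable huc
  have h1 := gate_near hZ hσ hcσ hb hw
  obtain ⟨q, h, hq⟩ := hw
  have h2 := near_off_of_mem (notMem_support_of_isGeodesic_concat hq)
  have h3 := hq.length_le_of_near (hua.trans ha)
  rw [SimpleGraph.Walk.length_concat] at h3
  exact ((h1.trans h2.symm).trans ((near_off_of_mem hη.2).mono hη₂)).mono (by omega)

end IsGate

/-! ### Vertices and cones on geodesics -/

/-- The vertex `z` lies on some geodesic from `x` to `y`. -/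
def Btw {A : Type*} (Z : SimpleGraph A) (x y z : A) : Prop :=
  ∃ (p : Z.Walk x z) (q : Z.Walk z y), IsGeodesic (p.append q)

/-- Some geodesic from `x` to `y` passes through `a`, `c`, `b` consecutively. -/
def Thru {A : Type*} (Z : SimpleGraph A) (c a b x y : A) : Prop :=
  ∃ (p : Z.Walk x a) (h₁ : Z.Adj a c) (h₂ : Z.Adj c b) (q : Z.Walk b y),
    IsGeodesic (p.append (.cons h₁ (.cons h₂ q)))

section Btw

variable {A : Type*} {Z : SimpleGraph A} {a b c x y z : A}

theorem Btw.symm (h : Btw Z x y z) : Btw Z y x z := by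
  obtain ⟨p, q, h⟩ := h
  exact ⟨q.reverse, p.reverse, by simpa using h.reverse⟩

theorem Thru.symm (h : Thru Z c a b x y) : Thru Z c b a y x := by
  obtain ⟨p, h₁, h₂, q, h⟩ := h
  refine ⟨q.reverse, h₂.symm, h₁.symm, p.reverse, ?_⟩
  simpa only [SimpleGraph.Walk.reverse_append, SimpleGraph.Walk.reverse_cons,
    ← SimpleGraph.Walk.append_assoc, SimpleGraph.Walk.cons_append,
    SimpleGraph.Walk.nil_append] using h.reverse

theorem Thru.btw_left (h : Thru Z c a b x y) : Btw Z x y a := by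
  obtain ⟨p, h₁, h₂, q, h⟩ := h
  exact ⟨p, _, h⟩

theorem Thru.btw_right (h : Thru Z c a b x y) : Btw Z x y b := h.symm.btw_left.symm

theorem Thru.exists_left (h : Thru Z c a b x y) :
    Z.Adj a c ∧ ∃ p : Z.Walk x a, IsGeodesic p ∧ c ∉ p.support := by
  obtain ⟨p, h₁, h₂, q, h⟩ := h
  have h' : IsGeodesic ((p.concat h₁).append (.cons h₂ q)) := by
    rwa [SimpleGraph.Walk.concat_append]
  exact ⟨h₁, p, h.append_left, notMem_support_of_isGeodesic_concat h'.append_left⟩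

theorem exists_thru_of_mem_support {γ : Z.Walk x y} (hγ : IsGeodesic γ) (hc : c ∈ γ.support)
    (hx : x ≠ c) (hy : y ≠ c) : ∃ a b, Thru Z c a b x y := by
  obtain ⟨p, q, rfl⟩ := SimpleGraph.Walk.mem_support_iff_exists_append.1 hc
  obtain ⟨a, p, h₁, rfl⟩ := exists_concat_of_ne p hx
  cases q with
  | nil => exact absurd rfl hy
  | cons h₂ q =>
    rw [SimpleGraph.Walk.concat_append] at hγ
    exact ⟨a, _, p, h₁, h₂, q, hγ⟩

theorem Btw.exists_avoiding (h : Btw Z x y z) (hz : z ≠ c) :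
    (∃ p : Z.Walk x z, IsGeodesic p ∧ c ∉ p.support) ∨
      ∃ q : Z.Walk z y, IsGeodesic q ∧ c ∉ q.support := by
  obtain ⟨p, q, h⟩ := h
  by_cases hp : c ∈ p.support
  · by_cases hq : c ∈ q.support
    · obtain ⟨p₁, p₂, rfl⟩ := SimpleGraph.Walk.mem_support_iff_exists_append.1 hp
      obtain ⟨q₁, q₂, rfl⟩ := SimpleGraph.Walk.mem_support_iff_exists_append.1 hq
      have h1 := h.length_le (p₁.append q₂)
      simp only [SimpleGraph.Walk.length_append] at h1
      exact absurd (SimpleGraph.Walk.eq_of_length_eq_zero (p := q₁) (by omega)) hz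
    · exact Or.inr ⟨q, h.append_right, hq⟩
  · exact Or.inl ⟨p, h.append_left, hp⟩

end Btw

theorem Slim.near_of_near_ends {A : Type*} {H : SimpleGraph A} {δ N : ℕ} (hH : Slim H δ)
    {a e a₁ e₁ : A} {r : H.Walk a e} {r₁ : H.Walk a₁ e₁} (hr : IsGeodesic r) (hr₁ : IsGeodesic r₁)
    (ha : Near H N a a₁) (he : Near H N e e₁) {u : A} (hu : u ∈ r.support) :
    ∃ v ∈ r₁.support, Near H (2 * δ + N) u v := by
  obtain ⟨s, hs⟩ := exists_isGeodesic he.reachable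
  obtain ⟨t, ht⟩ := exists_isGeodesic ha.reachable
  obtain ⟨d, hd⟩ := exists_isGeodesic (H := H) ⟨r.append s⟩
  have hsl := hs.length_le_of_near he
  have htl := ht.length_le_of_near ha
  obtain ⟨v, hv | hv, huv⟩ := hH _ _ _ r s d hr hs hd u hu
  · exact ⟨e₁, r₁.end_mem_support,
      (huv.trans (near_of_mem_support hv s.end_mem_support)).mono (by omega)⟩
  · obtain ⟨w, hw | hw, hvw⟩ := hH _ _ _ d r₁.reverse t hd hr₁.reverse ht v hv
    · exact ⟨w, by simpa using hw, (huv.trans hvw).mono (by omega)⟩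
    · exact ⟨a₁, r₁.start_mem_support,
        ((huv.trans hvw).trans (near_of_mem_support hw t.end_mem_support)).mono (by omega)⟩

/-! ### Removing cone vertices from a hyperbolic graph -/

/-- The vertices in `T` are pairwise non-adjacent, and the neighbours of `c ∈ T` lie in a hyperbolic
subgraph `B c` that is undistorted in the complement of `c`. -/
structure ConeSystem {A : Type*} (E : SimpleGraph A) (S T : Set A) (B : A → Set A) (δ K : ℕ) :
    Prop where
  notMem : ∀ c ∈ T, c ∉ S
  hyp : Hyp E (S ∪ T) δ
  indep : ∀ c ∈ T, ∀ v ∈ S ∪ T, E.Adj c v → v ∈ S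
  cone_subset : ∀ c ∈ T, B c ⊆ S
  mem_cone : ∀ c ∈ T, ∀ v ∈ S, E.Adj c v → v ∈ B c
  hyp_cone : ∀ c ∈ T, Hyp E (B c) δ
  undistorted : ∀ c ∈ T, ∀ a ∈ B c, ∀ b ∈ B c, ∀ m,
    Near (restr E ((S ∪ T) \ {c})) m a b → Near (restr E (B c)) (K * (m + 1)) a b

namespace ConeSystem

variable {A : Type*} {E : SimpleGraph A} {S T : Set A} {B : A → Set A} {δ K : ℕ}

/-- The vertices of `S` on geodesics between `x` and `y`, and those on the geodesics of the
subgraphs `B c` that replace the passages through `c`. -/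
def deelectrified (E : SimpleGraph A) (S T : Set A) (B : A → Set A) (x y : A) : Set A :=
  {z | (z ∈ S ∧ Btw (restr E (S ∪ T)) x y z) ∨
    ∃ c ∈ T, ∃ a b, Thru (restr E (S ∪ T)) c a b x y ∧
      ∃ r : (restr E (B c)).Walk a b, IsGeodesic r ∧ z ∈ r.support}

theorem deelectrified_symm {x y z : A} (h : z ∈ deelectrified E S T B x y) :
    z ∈ deelectrified E S T B y x := by
  rcases h with ⟨hz, h⟩ | ⟨c, hc, a, b, h, r, hr, hz⟩
  · exact Or.inl ⟨hz, h.symm⟩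
  · exact Or.inr ⟨c, hc, b, a, h.symm, r.reverse, hr.reverse, by simpa using hz⟩

/-- The constant in the bounded geodesic image property of the cones. -/
def imageConst (δ K : ℕ) : ℕ := K * (8 * δ + 6 + 1)

theorem mem_of_adj (h : ConeSystem E S T B δ K) {c a : A} (hc : c ∈ T)
    (ha : (restr E (S ∪ T)).Adj a c) : a ∈ S :=
  h.indep c hc a ha.2.1 ha.1.symm

theorem mem_cone_of_adj (h : ConeSystem E S T B δ K) {c a : A} (hc : c ∈ T)
    (ha : (restr E (S ∪ T)).Adj a c) : a ∈ B c :=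
  h.mem_cone c hc a (h.mem_of_adj hc ha) ha.1.symm

theorem ne_of_mem (h : ConeSystem E S T B δ K) {c x : A} (hc : c ∈ T) (hx : x ∈ S) : x ≠ c :=
  fun e ↦ h.notMem c hc (e ▸ hx)

theorem near_of_near_cone (h : ConeSystem E S T B δ K) {c a b : A} {n : ℕ} (hc : c ∈ T)
    (hab : Near (restr E (B c)) n a b) : Near (restr E S) n a b :=
  hab.mono_graph (restr_mono (h.cone_subset c hc))

theorem reachable (h : ConeSystem E S T B δ K) {x y : A} (hx : x ∈ S ∪ T) (hy : y ∈ S ∪ T) :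
    (restr E (S ∪ T)).Reachable x y := h.hyp.conn x hx y hy

/-- Bounded geodesic image: gates play the role of projections to `B c`, and `undistorted` turns
closeness off `c` into closeness in `B c`. -/
theorem near_gates (h : ConeSystem E S T B δ K) {c x y a b : A} (hc : c ∈ T)
    {γ : (restr E (S ∪ T)).Walk x y} (hγ : IsGeodesic γ) (hcγ : c ∉ γ.support)
    (ha : IsGate (restr E (S ∪ T)) c x a) (hb : IsGate (restr E (S ∪ T)) c y b) :
    Near (restr E (B c)) (imageConst δ K) a b := by
  have h1 := gate_near h.hyp.slim hγ hcγ ha hb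
  rw [restr_restr_compl] at h1
  obtain ⟨-, ha, -⟩ := ha
  obtain ⟨-, hb, -⟩ := hb
  exact h.undistorted c hc a (h.mem_cone_of_adj hc ha) b (h.mem_cone_of_adj hc hb) _ h1

theorem exists_gate (h : ConeSystem E S T B δ K) {c x : A} (hc : c ∈ T) (hx : x ∈ S) :
    ∃ a, IsGate (restr E (S ∪ T)) c x a :=
  exists_isGate (h.reachable (Or.inl hx) (Or.inr hc)) (h.ne_of_mem hc hx)

theorem near_gate_of_thru (h : ConeSystem E S T B δ K) {c a b x y a' : A} (hc : c ∈ T)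
    (ht : Thru (restr E (S ∪ T)) c a b x y) (ha' : IsGate (restr E (S ∪ T)) c x a') :
    Near (restr E (B c)) (imageConst δ K) a' a := by
  obtain ⟨hac, p, hp, hcp⟩ := ht.exists_left
  exact h.near_gates hc hp hcp ha' (isGate_self hac)

theorem exists_thru (h : ConeSystem E S T B δ K) {c x y a' b' : A} (hc : c ∈ T) (hx : x ∈ S)
    (hy : y ∈ S) (ha' : IsGate (restr E (S ∪ T)) c x a') (hb' : IsGate (restr E (S ∪ T)) c y b')
    (hfar : ¬ Near (restr E (B c)) (imageConst δ K) a' b') :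
    ∃ a b, Thru (restr E (S ∪ T)) c a b x y := by
  obtain ⟨γ, hγ⟩ := exists_isGeodesic (h.reachable (Or.inl hx) (Or.inl hy))
  by_cases hcγ : c ∈ γ.support
  · exact exists_thru_of_mem_support hγ hcγ (h.ne_of_mem hc hx) (h.ne_of_mem hc hy)
  · exact absurd (h.near_gates hc hγ hcγ ha' hb') hfar

theorem near_gate_of_btw (h : ConeSystem E S T B δ K) {c x y z a' b' z' : A} (hc : c ∈ T)
    (hz : z ∈ S) (hb : Btw (restr E (S ∪ T)) x y z) (ha' : IsGate (restr E (S ∪ T)) c x a')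
    (hb' : IsGate (restr E (S ∪ T)) c y b') (hz' : IsGate (restr E (S ∪ T)) c z z') :
    Near (restr E (B c)) (imageConst δ K) z' a' ∨ Near (restr E (B c)) (imageConst δ K) z' b' := by
  rcases hb.exists_avoiding (h.ne_of_mem hc hz) with ⟨p, hp, hcp⟩ | ⟨q, hq, hcq⟩
  · exact Or.inl (h.near_gates hc hp hcp ha' hz').symm
  · exact Or.inr (h.near_gates hc hq hcq hz' hb')

/-- A walk either makes only short jumps through cone vertices, or has a first long one. -/
theorem near_or_exists_jump (h : ConeSystem E S T B δ K) {M : ℕ} (hM : 1 ≤ M) (n : ℕ) {z z' : A}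
    (hz : z ∈ S) (hz' : z' ∈ S) (σ : (restr E (S ∪ T)).Walk z z') (hn : σ.length ≤ n) :
    Near (restr E S) (M * σ.length) z z' ∨
      ∃ c ∈ T, ∃ (a b : A) (p : (restr E (S ∪ T)).Walk z a) (h₁ : (restr E (S ∪ T)).Adj a c)
        (h₂ : (restr E (S ∪ T)).Adj c b) (q : (restr E (S ∪ T)).Walk b z'),
        σ = p.append (.cons h₁ (.cons h₂ q)) ∧ Near (restr E S) (M * p.length) z a ∧
        ¬ Near (restr E (B c)) M a b := by
  induction n generalizing z with
  | zero =>
    have := SimpleGraph.Walk.eq_of_length_eq_zero (Nat.le_zero.1 hn)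
    exact Or.inl (Near.of_eq this)
  | succ n ih =>
    cases σ with
    | nil => exact Or.inl (Near.refl _ _ _)
    | @cons _ v _ hv σ =>
      rw [SimpleGraph.Walk.length_cons] at hn ⊢
      rcases hv.2.2 with hvS | hvT
      · have hzv : Near (restr E S) M z v :=
          (Near.of_adj (H := restr E S) ⟨hv.1, hz, hvS⟩).mono hM
        rcases ih hvS σ (by omega) with h1 | ⟨c, hc, a, b, p, h₁, h₂, q, rfl, hp, hfar⟩
        · exact Or.inl ((hzv.trans h1).mono (le_of_eq (by ring)))
        · refine Or.inr ⟨c, hc, a, b, .cons hv p, h₁, h₂, q, by simp, ?_, hfar⟩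
          exact (hzv.trans hp).mono (le_of_eq (by rw [SimpleGraph.Walk.length_cons]; ring))
      · cases σ with
        | nil => exact absurd hz' (h.notMem _ hvT)
        | @cons _ b _ hb σ =>
          have hbS := h.mem_of_adj hvT hb.symm
          by_cases hzb : Near (restr E (B v)) M z b
          · have hzb' := h.near_of_near_cone hvT hzb
            rw [SimpleGraph.Walk.length_cons] at hn ⊢
            rcases ih hbS σ (by omega) with h1 | ⟨c, hc, a, b', p, h₁, h₂, q, rfl, hp, hfar⟩
            · exact Or.inl ((hzb'.trans h1).mono (by nlinarith))
            · refine Or.inr ⟨c, hc, a, b', .cons hv (.cons hb p), h₁, h₂, q, by simp, ?_, hfar⟩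
              refine (hzb'.trans hp).mono ?_
              rw [SimpleGraph.Walk.length_cons, SimpleGraph.Walk.length_cons]
              nlinarith
          · exact Or.inr ⟨v, hvT, z, b, .nil, hv, hb, σ, by simp, Near.refl _ _ _, hzb⟩

theorem mem_deelectrified_of_thru (h : ConeSystem E S T B δ K) {c a b x y : A} (hc : c ∈ T)
    (ht : Thru (restr E (S ∪ T)) c a b x y) : a ∈ deelectrified E S T B x y :=
  Or.inl ⟨h.mem_of_adj hc ht.exists_left.1, ht.btw_left⟩

/-- A short geodesic from `z` to `z'` lifts to `S` unless it makes a long jump through some cone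
vertex `c`. Such a jump separates the gates of `z` and `z'`, so the gates of `x`, `w`, `y` cannot
all be close. Hence a geodesic of one of the two sides runs through `c`, entering or leaving near
the gate of `z`, which is near `z` because the jump is the first long one. -/
theorem near_deelectrified_of_near_btw (h : ConeSystem E S T B δ K) {x y w z z' : A} (hx : x ∈ S)
    (hy : y ∈ S) (hw : w ∈ S) (hz : z ∈ S) (hxyz : Btw (restr E (S ∪ T)) x y z) (hz' : z' ∈ S)
    (hbtw : Btw (restr E (S ∪ T)) x w z' ∨ Btw (restr E (S ∪ T)) w y z') {n : ℕ}
    (hn : Near (restr E (S ∪ T)) n z z') :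
    ∃ v, (v ∈ deelectrified E S T B x w ∨ v ∈ deelectrified E S T B w y) ∧
      Near (restr E S) ((6 * imageConst δ K + 1) * n + 4 * imageConst δ K) z v := by
  set β := imageConst δ K with hβ
  obtain ⟨σ, hσ⟩ := exists_isGeodesic hn.reachable
  have hσn := hσ.length_le_of_near hn
  -- If both sides had close gates, then `a`, `pz`, `pw`, `pz'`, `b` would be successively within
  -- `β`, `2 * β`, `2 * β`, `β`, so a jump longer than `6 * β` excludes this.
  rcases h.near_or_exists_jump (M := 6 * β + 1) (by omega) _ hz hz' σ le_rfl with
    h1 | ⟨c, hc, a, b, p, h₁, h₂, q, rfl, hp, hfar⟩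
  · refine ⟨z', ?_, h1.mono (le_trans (Nat.mul_le_mul_left _ hσn) (by omega))⟩
    rcases hbtw with hb | hb
    · exact Or.inl (Or.inl ⟨hz', hb⟩)
    · exact Or.inr (Or.inl ⟨hz', hb⟩)
  · obtain ⟨px, hpx⟩ := h.exists_gate hc hx
    obtain ⟨py, hpy⟩ := h.exists_gate hc hy
    obtain ⟨pw, hpw⟩ := h.exists_gate hc hw
    obtain ⟨pz, hpz⟩ := h.exists_gate hc hz
    obtain ⟨pz', hpz'⟩ := h.exists_gate hc hz'
    have ht : Thru (restr E (S ∪ T)) c a b z z' := ⟨p, h₁, h₂, q, hσ⟩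
    have hza := h.near_gate_of_thru hc ht hpz
    have hzb := h.near_gate_of_thru hc ht.symm hpz'
    have hpn : (6 * β + 1) * p.length ≤ (6 * β + 1) * n := by
      refine Nat.mul_le_mul_left _ (le_trans ?_ hσn)
      rw [SimpleGraph.Walk.length_append]
      omega
    have hzpz : Near (restr E S) ((6 * β + 1) * n + β) z pz :=
      (hp.mono hpn).trans (h.near_of_near_cone hc hza.symm)
    have hside : ∀ {s t ps pt : A}, s ∈ S → t ∈ S → IsGate (restr E (S ∪ T)) c s ps →
        IsGate (restr E (S ∪ T)) c t pt → ¬ Near (restr E (B c)) β ps pt →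
        Near (restr E (B c)) (2 * β) pz ps → ∃ v ∈ deelectrified E S T B s t,
          Near (restr E S) ((6 * β + 1) * n + 4 * β) z v := by
      intro s t ps pt hs ht hps hpt hst hzs
      obtain ⟨a₁, b₁, ht₁⟩ := h.exists_thru hc hs ht hps hpt hst
      refine ⟨a₁, h.mem_deelectrified_of_thru hc ht₁, ?_⟩
      exact (hzpz.trans (h.near_of_near_cone hc
        (hzs.trans (h.near_gate_of_thru hc ht₁ hps)))).mono (by omega)
    have hz1 := h.near_gate_of_btw hc hz hxyz hpx hpy hpz
    by_cases hxw : Near (restr E (B c)) β px pw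
    · by_cases hwy : Near (restr E (B c)) β pw py
      · exfalso
        have hz2 : Near (restr E (B c)) (2 * β) pz pw := by
          rcases hz1 with h1 | h1
          · exact (h1.trans hxw).mono (by omega)
          · exact (h1.trans hwy.symm).mono (by omega)
        have hz3 : Near (restr E (B c)) (2 * β) pz' pw := by
          rcases hbtw with hb | hb
          · rcases h.near_gate_of_btw hc hz' hb hpx hpw hpz' with h1 | h1
            · exact (h1.trans hxw).mono (by omega)
            · exact h1.mono (by omega)
          · rcases h.near_gate_of_btw hc hz' hb hpw hpy hpz' with h1 | h1
            · exact h1.mono (by omega)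
            · exact (h1.trans hwy.symm).mono (by omega)
        exact hfar ((((hza.symm.trans hz2).trans hz3.symm).trans hzb).mono (by omega))
      · rcases hz1 with h1 | h1
        · obtain ⟨v, hv, hvn⟩ := hside hw hy hpw hpy hwy ((h1.trans hxw).mono (by omega))
          exact ⟨v, Or.inr hv, hvn⟩
        · obtain ⟨v, hv, hvn⟩ := hside hy hw hpy hpw (fun hn ↦ hwy hn.symm) (h1.mono (by omega))
          exact ⟨v, Or.inr (deelectrified_symm hv), hvn⟩
    · rcases hz1 with h1 | h1
      · obtain ⟨v, hv, hvn⟩ := hside hx hw hpx hpw hxw (h1.mono (by omega))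
        exact ⟨v, Or.inl hv, hvn⟩
      · by_cases hwy : Near (restr E (B c)) β pw py
        · obtain ⟨v, hv, hvn⟩ := hside hw hx hpw hpx (fun hn ↦ hxw hn.symm)
            ((h1.trans hwy.symm).mono (by omega))
          exact ⟨v, Or.inl (deelectrified_symm hv), hvn⟩
        · obtain ⟨v, hv, hvn⟩ := hside hy hw hpy hpw (fun hn ↦ hwy hn.symm) (h1.mono (by omega))
          exact ⟨v, Or.inr (deelectrified_symm hv), hvn⟩

theorem exists_btw_near (h : ConeSystem E S T B δ K) {x y v : A} (hx : x ∈ S)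
    {γ : (restr E (S ∪ T)).Walk x y} (hγ : IsGeodesic γ) (hv : v ∈ γ.support) :
    ∃ z ∈ S, Btw (restr E (S ∪ T)) x y z ∧ Near (restr E (S ∪ T)) 1 v z := by
  have hxS : x ∈ S ∪ T := Or.inl hx
  have hvS := mem_of_mem_support_restr hxS γ v hv
  obtain ⟨p, q, rfl⟩ := SimpleGraph.Walk.mem_support_iff_exists_append.1 hv
  rcases hvS with hvS | hvT
  · exact ⟨v, hvS, ⟨p, q, hγ⟩, Near.refl _ _ _⟩
  · obtain ⟨a, p, hav, rfl⟩ := exists_concat_of_ne p (h.ne_of_mem hvT hx)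
    rw [SimpleGraph.Walk.concat_append] at hγ
    exact ⟨a, h.mem_of_adj hvT hav, ⟨p, _, hγ⟩, Near.of_adj hav.symm⟩

/-- The slimness constant for vertices of geodesics of the coned-off graph. -/
def btwConst (δ K : ℕ) : ℕ := (6 * imageConst δ K + 1) * (δ + 1) + 4 * imageConst δ K

theorem near_deelectrified_of_btw (h : ConeSystem E S T B δ K) {x y w z : A} (hx : x ∈ S)
    (hy : y ∈ S) (hw : w ∈ S) (hz : z ∈ S) (hxyz : Btw (restr E (S ∪ T)) x y z) :
    ∃ v, (v ∈ deelectrified E S T B x w ∨ v ∈ deelectrified E S T B w y) ∧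
      Near (restr E S) (btwConst δ K) z v := by
  obtain ⟨γ₁, hγ₁⟩ := exists_isGeodesic (h.reachable (Or.inl hx) (Or.inl hw))
  obtain ⟨γ₂, hγ₂⟩ := exists_isGeodesic (h.reachable (Or.inl hw) (Or.inl hy))
  obtain ⟨p, q, hpq⟩ := id hxyz
  obtain ⟨v, hv, hzv⟩ := h.hyp.slim x y w _ γ₂.reverse γ₁ hpq hγ₂.reverse hγ₁ z
    ((SimpleGraph.Walk.mem_support_append_iff _ _).2 (Or.inl p.end_mem_support))
  obtain ⟨z', hz', hb, hvz'⟩ : ∃ z' ∈ S, (Btw (restr E (S ∪ T)) x w z' ∨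
      Btw (restr E (S ∪ T)) w y z') ∧ Near (restr E (S ∪ T)) 1 v z' := by
    rcases hv with hv | hv
    · obtain ⟨z', hz', hb, hn⟩ := h.exists_btw_near hw hγ₂ (by simpa using hv)
      exact ⟨z', hz', Or.inr hb, hn⟩
    · obtain ⟨z', hz', hb, hn⟩ := h.exists_btw_near hx hγ₁ hv
      exact ⟨z', hz', Or.inl hb, hn⟩
  exact h.near_deelectrified_of_near_btw hx hy hw hz hxyz hz' hb (hzv.trans hvz')

/-- Either the gates of `s` and `w` are close and `r` is short, or the side from `s` to `w` itself
passes through `c`, and its replacement geodesic in `B c` has ends close to those of `r`. -/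
theorem near_side_of_cone (h : ConeSystem E S T B δ K) {c s w a ps pw : A} (hc : c ∈ T)
    (hs : s ∈ S) (hw : w ∈ S) (hps : IsGate (restr E (S ∪ T)) c s ps)
    (hpw : IsGate (restr E (S ∪ T)) c w pw)
    (ha : Near (restr E (B c)) (imageConst δ K) ps a) {r : (restr E (B c)).Walk a pw}
    (hr : IsGeodesic r) {v : A} (hv : v ∈ r.support) :
    Near (restr E (B c)) (2 * imageConst δ K) v a ∨
      ∃ u ∈ deelectrified E S T B s w,
        Near (restr E (B c)) (2 * δ + 2 * imageConst δ K) v u := by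
  by_cases hfar : Near (restr E (B c)) (imageConst δ K) ps pw
  · have h1 := hr.length_le_of_near (ha.symm.trans hfar)
    exact Or.inl ((near_of_mem_support hv r.start_mem_support).mono (by omega))
  · obtain ⟨a₁, b₁, ht⟩ := h.exists_thru hc hs hw hps hpw hfar
    have ha₁ := h.near_gate_of_thru hc ht hps
    have hb₁ := h.near_gate_of_thru hc ht.symm hpw
    obtain ⟨r₁, hr₁⟩ := exists_isGeodesic ((h.hyp_cone c hc).conn a₁
      (h.mem_cone_of_adj hc ht.exists_left.1) b₁ (h.mem_cone_of_adj hc ht.symm.exists_left.1))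
    obtain ⟨u, hu, hvu⟩ := (h.hyp_cone c hc).slim.near_of_near_ends hr hr₁
      ((ha.symm.trans ha₁).mono (show _ ≤ 2 * imageConst δ K by omega)) (hb₁.mono (by omega)) hv
    exact Or.inr ⟨u, Or.inr ⟨c, hc, a₁, b₁, ht, r₁, hr₁, hu⟩, hvu⟩

/-- The slimness constant of the de-electrified geodesics. -/
def guessConst (δ K : ℕ) : ℕ := 3 * δ + 2 * imageConst δ K + btwConst δ K + 1

/-- For a point on a replacement geodesic, use slimness in `B c` of the triangle formed by `a`, `b`
and the gate of `w`. If the side that is reached is short, the point is close to `a` or `b`, which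
lie on a geodesic from `x` to `y`. -/
theorem thin (h : ConeSystem E S T B δ K) {x y w z : A} (hx : x ∈ S)
    (hy : y ∈ S) (hw : w ∈ S) (hz : z ∈ deelectrified E S T B x y) :
    ∃ v, (v ∈ deelectrified E S T B x w ∨ v ∈ deelectrified E S T B w y) ∧
      Near (restr E S) (guessConst δ K) z v := by
  unfold guessConst
  rcases hz with ⟨hz, hb⟩ | ⟨c, hc, a, b, ht, r, hr, hz⟩
  · obtain ⟨v, hv, hn⟩ := h.near_deelectrified_of_btw hx hy hw hz hb
    exact ⟨v, hv, hn.mono (by omega)⟩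
  · obtain ⟨px, hpx⟩ := h.exists_gate hc hx
    obtain ⟨py, hpy⟩ := h.exists_gate hc hy
    obtain ⟨pw, hpw⟩ := h.exists_gate hc hw
    have ha := h.near_gate_of_thru hc ht hpx
    have hb := h.near_gate_of_thru hc ht.symm hpy
    have hac := ht.exists_left.1
    have hbc := ht.symm.exists_left.1
    have hpwB : pw ∈ B c := by
      obtain ⟨-, h1, -⟩ := id hpw
      exact h.mem_cone_of_adj hc h1
    obtain ⟨r₁, hr₁⟩ := exists_isGeodesic
      ((h.hyp_cone c hc).conn a (h.mem_cone_of_adj hc hac) pw hpwB)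
    obtain ⟨r₂, hr₂⟩ := exists_isGeodesic
      ((h.hyp_cone c hc).conn b (h.mem_cone_of_adj hc hbc) pw hpwB)
    obtain ⟨v, hv | hv, hzv⟩ := (h.hyp_cone c hc).slim a b pw r r₂ r₁ hr hr₂ hr₁ z hz
    · rcases h.near_side_of_cone hc hy hw hpy hpw hb hr₂ hv with h1 | ⟨u, hu, h1⟩
      · obtain ⟨u, hu, hbu⟩ := h.near_deelectrified_of_btw hx hy hw
          (h.mem_of_adj hc hbc) ht.btw_right
        exact ⟨u, hu, ((h.near_of_near_cone hc (hzv.trans h1)).trans hbu).mono (by omega)⟩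
      · exact ⟨u, Or.inr (deelectrified_symm hu),
          (h.near_of_near_cone hc (hzv.trans h1)).mono (by omega)⟩
    · rcases h.near_side_of_cone hc hx hw hpx hpw ha hr₁ hv with h1 | ⟨u, hu, h1⟩
      · obtain ⟨u, hu, hau⟩ := h.near_deelectrified_of_btw hx hy hw
          (h.mem_of_adj hc hac) ht.btw_left
        exact ⟨u, hu, ((h.near_of_near_cone hc (hzv.trans h1)).trans hau).mono (by omega)⟩
      · exact ⟨u, Or.inl hu, (h.near_of_near_cone hc (hzv.trans h1)).mono (by omega)⟩

theorem small {x y z : A} (hxy : Near (restr E S) 1 x y)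
    (hz : z ∈ deelectrified E S T B x y) : Near (restr E S) 1 z x := by
  have hxy' := hxy.mono_graph (restr_mono (E := E) (Set.subset_union_left (t := T)))
  rcases hz with ⟨-, p, q, hpq⟩ | ⟨c, hc, a, b, ⟨p, h₁, h₂, q, hpq⟩, -⟩
  · have := hpq.length_le_of_near hxy'
    rw [SimpleGraph.Walk.length_append] at this
    rcases Nat.eq_zero_or_pos p.length with h0 | h0
    · exact Near.of_eq (SimpleGraph.Walk.eq_of_length_eq_zero h0).symm
    · rw [SimpleGraph.Walk.eq_of_length_eq_zero (p := q) (by omega)]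
      exact hxy.symm
  · have := hpq.length_le_of_near hxy'
    simp only [SimpleGraph.Walk.length_append, SimpleGraph.Walk.length_cons] at this
    omega

/-- Follow the geodesic from one vertex of `S` to the next. If `P` fails only across a cone vertex,
it already fails along an edge of the replacement geodesic. -/
theorem cut_aux (h : ConeSystem E S T B δ K) {x y : A} (P : A → Prop) (hPy : ¬ P y)
    (hy : y ∈ S) (n : ℕ) {z : A} (hz : z ∈ S) (hPz : P z) (p : (restr E (S ∪ T)).Walk x z)
    (σ : (restr E (S ∪ T)).Walk z y) (hσ : IsGeodesic (p.append σ)) (hn : σ.length ≤ n) :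
    ∃ u ∈ deelectrified E S T B x y, ∃ v ∈ deelectrified E S T B x y,
      P u ∧ ¬ P v ∧ Near (restr E S) 1 u v := by
  induction n generalizing z with
  | zero =>
    have := SimpleGraph.Walk.eq_of_length_eq_zero (Nat.le_zero.1 hn)
    exact absurd (this ▸ hPz) hPy
  | succ n ih =>
    cases σ with
    | nil => exact absurd hPz hPy
    | @cons _ v _ hv σ =>
      have hσ' : IsGeodesic ((p.concat hv).append σ) := by rwa [SimpleGraph.Walk.concat_append]
      rw [SimpleGraph.Walk.length_cons] at hn
      rcases hv.2.2 with hvS | hvT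
      · by_cases hPv : P v
        · exact ih hvS hPv _ σ hσ' (by omega)
        · exact ⟨z, Or.inl ⟨hz, p, _, hσ⟩, v, Or.inl ⟨hvS, _, _, hσ'⟩, hPz, hPv,
            Near.of_adj ⟨hv.1, hz, hvS⟩⟩
      · cases σ with
        | nil => exact absurd hy (h.notMem _ hvT)
        | @cons _ b _ hb σ =>
          have hbS := h.mem_of_adj hvT hb.symm
          have hσ'' : IsGeodesic (((p.concat hv).concat hb).append σ) := by
            rwa [SimpleGraph.Walk.concat_append]
          rw [SimpleGraph.Walk.length_cons] at hn
          by_cases hPb : P b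
          · exact ih hbS hPb _ σ hσ'' (by omega)
          · obtain ⟨r, hr⟩ := exists_isGeodesic ((h.hyp_cone v hvT).conn z
              (h.mem_cone_of_adj hvT hv) b (h.mem_cone_of_adj hvT hb.symm))
            obtain ⟨u, hu, w, hw, huw, hPu, hPw⟩ := exists_adj_of_walk r P hPz hPb
            have ht : Thru (restr E (S ∪ T)) v z b x y := ⟨p, hv, hb, σ, hσ⟩
            exact ⟨u, Or.inr ⟨v, hvT, z, b, ht, r, hr, hu⟩, w,
              Or.inr ⟨v, hvT, z, b, ht, r, hr, hw⟩, hPu, hPw,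
              h.near_of_near_cone hvT (Near.of_adj huw)⟩

theorem cut (h : ConeSystem E S T B δ K) {x y : A} (hx : x ∈ S) (hy : y ∈ S) (P : A → Prop)
    (hPx : P x) (hPy : ¬ P y) :
    ∃ u ∈ deelectrified E S T B x y, ∃ v ∈ deelectrified E S T B x y,
      P u ∧ ¬ P v ∧ Near (restr E S) 1 u v := by
  obtain ⟨γ, hγ⟩ := exists_isGeodesic (h.reachable (Or.inl hx) (Or.inl hy))
  exact h.cut_aux P hPy hy _ hx hPx .nil γ hγ le_rfl

theorem guessFamily (h : ConeSystem E S T B δ K) :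
    GuessFamily (restr E S) S (deelectrified E S T B) (guessConst δ K) where
  closed _ _ _ hxy := hxy.2.2
  conn x hx y hy := by
    -- Connectedness comes from `cut`, applied to the component of `x`.
    by_contra hxy
    obtain ⟨u, -, v, -, hu, hv, huv⟩ := h.cut hx hy (fun z ↦ (restr E S).Reachable x z)
      (SimpleGraph.Reachable.refl x) hxy
    exact hv (hu.trans huv.reachable)
  thin _ hx _ hy _ hw _ hz := h.thin hx hy hw hz
  small _ _ _ _ hxy _ hz := (ConeSystem.small hxy hz).mono (by unfold guessConst; omega)
  cut x hx y hy P hPx hPy := by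
    obtain ⟨u, hu, v, hv, hPu, hPv, huv⟩ := h.cut hx hy P hPx hPy
    exact ⟨u, hu, v, hv, hPu, hPv, huv.mono (by unfold guessConst; omega)⟩
  right_mem x hx y hy := by
    obtain ⟨γ, hγ⟩ := exists_isGeodesic (h.reachable (Or.inl hx) (Or.inl hy))
    exact Or.inl ⟨hy, γ, .nil, by simpa using hγ⟩

/-- Removing the cone vertices of a cone system leaves a hyperbolic graph. -/
theorem hyp_base (h : ConeSystem E S T B δ K) :
    Hyp E S (64 * (guessConst δ K + 1) ^ 2 + 2 * guessConst δ K) :=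
  h.guessFamily.hyp

end ConeSystem

/-! ### Induced subgraphs and restrictions -/

section induce

variable {A : Type*} {E : SimpleGraph A} {S : Set A}

theorem exists_walk_restr {x y : S} (p : (E.induce S).Walk x y) :
    ∃ q : (restr E S).Walk x.1 y.1, q.length = p.length ∧
      q.support = p.support.map Subtype.val := by
  induction p with
  | nil => exact ⟨.nil, rfl, rfl⟩
  | @cons x y _ h p ih =>
    obtain ⟨q, hq, hqs⟩ := ih
    have h' : (restr E S).Adj x.1 y.1 := ⟨h, x.2, y.2⟩
    exact ⟨.cons h' q, by simp [hq], by simp [hqs]⟩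

theorem exists_walk_induce {x y : A} (p : (restr E S).Walk x y) (hx : x ∈ S) :
    ∃ (hy : y ∈ S) (q : (E.induce S).Walk ⟨x, hx⟩ ⟨y, hy⟩), q.length = p.length ∧
      p.support = q.support.map Subtype.val := by
  induction p with
  | nil => exact ⟨hx, .nil, rfl, rfl⟩
  | cons h p ih =>
    obtain ⟨hy, q, hq, hqs⟩ := ih h.2.2
    have h' : (E.induce S).Adj ⟨_, hx⟩ ⟨_, h.2.2⟩ := h.1
    exact ⟨hy, .cons h' q, by simp [hq], by simp [hqs]⟩

theorem near_restr_iff {n : ℕ} {x y : S} :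
    Near (restr E S) n x.1 y.1 ↔ Near (E.induce S) n x y := by
  constructor
  · rintro ⟨p, hp⟩
    obtain ⟨hy, q, hq, -⟩ := exists_walk_induce p x.2
    exact ⟨q, hq.trans_le hp⟩
  · rintro ⟨p, hp⟩
    obtain ⟨q, hq, -⟩ := exists_walk_restr p
    exact ⟨q, hq.trans_le hp⟩

theorem isGeodesic_induce_iff {x y : S} {p : (E.induce S).Walk x y}
    {q : (restr E S).Walk x.1 y.1} (hpq : p.length = q.length) : IsGeodesic p ↔ IsGeodesic q := by
  rw [isGeodesic_iff, isGeodesic_iff, hpq]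
  constructor
  · intro h r
    obtain ⟨hy, r, hr, -⟩ := exists_walk_induce r x.2
    exact hr ▸ h r
  · intro h r
    obtain ⟨r, hr, -⟩ := exists_walk_restr r
    exact hr ▸ h r

theorem near_of_dist_le {B : Type*} {H : SimpleGraph B} {x y : B} {n : ℕ}
    (hr : H.Reachable x y) (h : H.dist x y ≤ n) : Near H n x y := by
  obtain ⟨p, hp⟩ := hr.exists_walk_length_eq_dist
  exact ⟨p, hp.trans_le h⟩

theorem IsHyperbolic.hyp {δ : ℝ} (h : IsHyperbolic (E.induce S) δ) : Hyp E S ⌈δ⌉₊ := by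
  refine ⟨fun x hx y hy ↦ ?_, ?_⟩
  · obtain ⟨p⟩ := h.1.preconnected ⟨x, hx⟩ ⟨y, hy⟩
    exact ⟨(exists_walk_restr p).choose⟩
  · intro a b c p q r hp hq hr u hu
    by_cases ha : a ∈ S
    · obtain ⟨hb, p', hp', hps⟩ := exists_walk_induce p ha
      obtain ⟨hc, q', hq', hqs⟩ := exists_walk_induce q hb
      obtain ⟨hc, r', hr', hrs⟩ := exists_walk_induce r ha
      rw [hps, List.mem_map] at hu
      obtain ⟨u, hu, rfl⟩ := hu
      obtain ⟨v, hv, huv⟩ := h.2 _ _ _ p' q' r' ((isGeodesic_induce_iff hp').2 hp)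
        ((isGeodesic_induce_iff hq').2 hq) ((isGeodesic_induce_iff hr').2 hr) u hu
      refine ⟨v.1, ?_, near_restr_iff.2 (near_of_dist_le (h.1.preconnected u v) ?_)⟩
      · rw [hqs, hrs, List.mem_map, List.mem_map]
        exact hv.imp (fun hv ↦ ⟨v, hv, rfl⟩) (fun hv ↦ ⟨v, hv, rfl⟩)
      · exact_mod_cast huv.trans (Nat.le_ceil δ)
    · cases p with
      | nil =>
        rw [SimpleGraph.Walk.support_nil, List.mem_singleton] at hu
        exact ⟨u, Or.inr (hu ▸ r.start_mem_support), Near.refl _ _ _⟩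
      | cons hab p => exact absurd hab.2.1 ha

end induce

/-! ### Ranks of domains -/

/-- The rank of `H` is the largest length of a chain of domains strictly below `H`; adjoining `H` to
a chain gives strict monotonicity. -/
theorem exists_rank {V : Type*} {G : SimpleGraph V} {𝔉 : Set (Set V)} {n : ℕ}
    (h : IsGraphFactorSystem G 𝔉 n) :
    ∃ r : Set V → ℕ, (∀ H ∈ 𝔉, r H < n) ∧ ∀ H ∈ 𝔉, ∀ K ∈ 𝔉, H ⊂ K → r H < r K := by
  set C : Set V → Set ℕ := fun H ↦
    {k | ∃ c : Fin k → Set V, (∀ i, c i ∈ 𝔉) ∧ StrictMono c ∧ ∀ i, c i ⊂ H} with hC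
  have h0 : ∀ H, 0 ∈ C H := fun H ↦
    ⟨Fin.elim0, fun i ↦ i.elim0, fun i ↦ i.elim0, fun i ↦ i.elim0⟩
  have hbdd : ∀ H, BddAbove (C H) := by
    rintro H
    refine ⟨n, ?_⟩
    rintro k ⟨c, hc, hm, -⟩
    exact (h.chain_lt k c hc hm).le
  have hmem : ∀ H, sSup (C H) ∈ C H := fun H ↦ Nat.sSup_mem ⟨0, h0 H⟩ (hbdd H)
  refine ⟨fun H ↦ sSup (C H), fun H _ ↦ ?_, fun H hH K _ hHK ↦ ?_⟩
  · obtain ⟨c, hc, hm, -⟩ := hmem H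
    exact h.chain_lt _ c hc hm
  · obtain ⟨c, hc, hm, hlt⟩ := hmem H
    refine Nat.lt_of_succ_le (le_csSup (hbdd K) ⟨Fin.snoc c H, ?_, ?_, ?_⟩)
    · intro i
      refine Fin.lastCases ?_ (fun j ↦ ?_) i
      · simpa using hH
      · simpa using hc j
    · intro i j
      refine Fin.lastCases (fun hij ↦ ?_) (fun j hij ↦ ?_) j
      · obtain ⟨i, rfl⟩ := Fin.exists_castSucc_eq.2 hij.ne
        simpa using hlt i
      · obtain ⟨i, rfl⟩ := Fin.exists_castSucc_eq.2 (hij.trans (Fin.castSucc_lt_last j)).ne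
        simpa using hm (by simpa using hij)
    · intro i
      refine Fin.lastCases ?_ (fun j ↦ ?_) i
      · simpa using hHK
      · simpa using (hlt j).trans hHK

/-! ### Augmented graphs without the link of a domain -/

section domains

variable {V : Type*} {G : SimpleGraph V} {𝔉 : Set (Set V)} {n : ℕ} {F H K : Set V}

/-- The link of `F` and the projection vertices of the domains in it. -/
def linkPart (G : SimpleGraph V) (𝔉 : Set (Set V)) (F : Set V) : Set (V ⊕ Set V) :=
  {a | (∃ v ∈ link G F, a = .inl v) ∨ ∃ H ∈ 𝔉, H ⊆ link G F ∧ a = .inr H}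

/-- The vertices of the augmented graph of `H` outside the link part of `F`. -/
def core (G : SimpleGraph V) (𝔉 : Set (Set V)) (F H : Set V) : Set (V ⊕ Set V) :=
  augVerts 𝔉 H \ linkPart G 𝔉 F

theorem inl_mem_linkPart {v : V} : .inl v ∈ linkPart G 𝔉 F ↔ v ∈ link G F := by
  simp [linkPart]

theorem inr_mem_linkPart : .inr K ∈ linkPart G 𝔉 F ↔ K ∈ 𝔉 ∧ K ⊆ link G F := by
  simp [linkPart]

theorem inl_mem_augVerts {v : V} : .inl v ∈ augVerts 𝔉 H ↔ v ∈ H := by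
  simp [augVerts]

theorem inr_mem_augVerts : .inr K ∈ augVerts 𝔉 H ↔ K ∈ 𝔉 ∧ K ⊂ H := by
  simp [augVerts]

theorem inl_mem_core {v : V} : .inl v ∈ core G 𝔉 F H ↔ v ∈ H ∧ v ∉ link G F := by
  rw [core, Set.mem_sdiff, inl_mem_augVerts, inl_mem_linkPart]

theorem inr_mem_core : .inr K ∈ core G 𝔉 F H ↔ (K ∈ 𝔉 ∧ K ⊂ H) ∧ ¬ K ⊆ link G F := by
  rw [core, Set.mem_sdiff, inr_mem_augVerts, inr_mem_linkPart]
  tauto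

theorem notMem_link_of_mem {v : V} (hv : v ∈ F) : v ∉ link G F :=
  fun h ↦ G.loopless.irrefl v (h v hv)

theorem not_subset_link (hF : F.Nonempty) (hFK : F ⊆ K) : ¬ K ⊆ link G F := by
  obtain ⟨f, hf⟩ := hF
  exact fun h ↦ notMem_link_of_mem hf (h (hFK hf))

theorem subset_link_singleton {u : V} (hu : u ∈ link G F) : F ⊆ link G {u} := by
  intro f hf v hv
  rw [Set.mem_singleton_iff.1 hv]
  exact (hu f hf).symm

variable {W : SimpleGraph (MaxClique G Set.univ)} {δ : ℝ}

/-- By the hierarchy condition the edge is seen by the graph on the maximal cliques of `H`. A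
maximal clique of `H` is not contained in the link of `F`, since a vertex of `F` could be added to
it; this provides `s`. -/
theorem IsCHHF.exists_adj_of_adj_link (h : IsCHHF G W 𝔉 n δ) (hF : F ∈ 𝔉) (hH : H ∈ 𝔉)
    (hFH : F ⊆ H) {u w : V} (hu : u ∈ H) (huF : u ∈ link G F) (hw : w ∈ H) (hwF : w ∉ link G F)
    (huw : (edgeGraph G Set.univ W).Adj (.inl u) (.inl w)) :
    ∃ s ∈ H, s ∉ link G F ∧ G.Adj u s ∧ Near (restr (edgeGraph G Set.univ W)
      (core G 𝔉 F H)) 1 (.inl s) (.inl w) := by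
  obtain ⟨WF, hWF⟩ := h.hierarchy
  have heq := (hWF H hH H hH le_rfl).1
  have hadj : ∀ s : V, s ∈ H → ((edgeGraph G H (WF H)).Adj (.inl s) (.inl w) ↔
      (edgeGraph G Set.univ W).Adj (.inl s) (.inl w)) := by
    intro s hs
    have := congrArg (fun g : SimpleGraph (augVerts 𝔉 H) ↦
      g.Adj ⟨.inl s, inl_mem_augVerts.2 hs⟩ ⟨.inl w, inl_mem_augVerts.2 hw⟩) heq
    exact Eq.to_iff this
  obtain ⟨hne, hG | ⟨x, y, hxy, hux, hwy⟩⟩ := (hadj u hu).2 huw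
  · exact ⟨w, hw, hwF, hG, Near.refl _ _ _⟩
  · obtain ⟨⟨hxH, hxc⟩, hmax⟩ := x.2
    obtain ⟨s, hsx, hsF⟩ : ∃ s ∈ x.1, s ∉ link G F := by
      by_contra! hcon
      obtain ⟨f, hf⟩ := h.factorSystem.nonempty_of_mem F hF
      have hins : insert f x.1 ⊆ H ∧ G.IsClique (insert f x.1) :=
        ⟨Set.insert_subset (hFH hf) hxH, hxc.insert fun v hv _ ↦ (hcon v hv f hf)⟩
      exact notMem_link_of_mem hf
        (hcon f (hmax hins (Set.subset_insert _ _) (Set.mem_insert _ _)))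
    refine ⟨s, hxH hsx, hsF, hxc hux hsx (fun e ↦ hsF (e ▸ huF)), ?_⟩
    by_cases hsw : s = w
    · exact Near.of_eq (by rw [hsw])
    · exact Near.of_adj ⟨(hadj s (hxH hsx)).1 ⟨hsw, Or.inr ⟨x, y, hxy, hsx, hwy⟩⟩,
        inl_mem_core.2 ⟨hxH hsx, hsF⟩, inl_mem_core.2 ⟨hw, hwF⟩⟩

/-- Both `s` and `F` lie in the domain `link G {u} ∩ H`, which is proper in `H` since it omits `u`.
Its projection vertex joins `s` to a vertex of `F`. -/
theorem IsCHHF.near_hub_of_adj (h : IsCHHF G W 𝔉 n δ) (hF : F ∈ 𝔉) (hH : H ∈ 𝔉)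
    (hFH : F ⊂ H) {u s : V} (hu : u ∈ H) (huF : u ∈ link G F) (hs : s ∈ H) (hsF : s ∉ link G F)
    (hus : G.Adj u s) :
    Near (restr (edgeGraph G Set.univ W) (core G 𝔉 F H)) 3 (.inl s) (.inr F) := by
  have hne := h.factorSystem.nonempty_of_mem F hF
  obtain ⟨f, hf⟩ := id hne
  have hFu := subset_link_singleton huF
  have hsu : s ∈ link G {u} := fun v hv ↦ by rw [Set.mem_singleton_iff.1 hv]; exact hus
  have hK : link G {u} ∩ H ∈ 𝔉 := h.factorSystem.inter_mem _
    (h.factorSystem.link_mem u ⟨f, hFu hf⟩) H hH ⟨f, hFu hf, hFH.1 hf⟩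
  have hKH : link G {u} ∩ H ⊂ H :=
    ⟨Set.inter_subset_right, fun hsub ↦ G.loopless.irrefl u ((hsub hu).1 u rfl)⟩
  have hKc : Sum.inr (link G {u} ∩ H) ∈ core G 𝔉 F H :=
    inr_mem_core.2 ⟨⟨hK, hKH⟩, not_subset_link hne (Set.subset_inter hFu hFH.1)⟩
  have hsc : Sum.inl s ∈ core G 𝔉 F H := inl_mem_core.2 ⟨hs, hsF⟩
  have hfc : Sum.inl f ∈ core G 𝔉 F H := inl_mem_core.2 ⟨hFH.1 hf, notMem_link_of_mem hf⟩
  have hFc : Sum.inr F ∈ core G 𝔉 F H :=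
    inr_mem_core.2 ⟨⟨hF, hFH⟩, not_subset_link hne le_rfl⟩
  have h1 : (restr (edgeGraph G Set.univ W) (core G 𝔉 F H)).Adj (.inl s)
      (.inr (link G {u} ∩ H)) := ⟨⟨hsu, hs⟩, hsc, hKc⟩
  have h2 : (restr (edgeGraph G Set.univ W) (core G 𝔉 F H)).Adj
      (.inr (link G {u} ∩ H)) (.inl f) := ⟨⟨hFu hf, hFH.1 hf⟩, hKc, hfc⟩
  have h3 : (restr (edgeGraph G Set.univ W) (core G 𝔉 F H)).Adj (.inl f) (.inr F) :=
    ⟨hf, hfc, hFc⟩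
  exact ((Near.of_adj h1).trans (Near.of_adj h2)).trans (Near.of_adj h3)

theorem IsCHHF.near_hub_of_adj_link (h : IsCHHF G W 𝔉 n δ) (hF : F ∈ 𝔉) (hH : H ∈ 𝔉)
    (hFH : F ⊂ H) {u w : V} (hu : u ∈ H) (huF : u ∈ link G F) (hw : w ∈ H) (hwF : w ∉ link G F)
    (huw : (edgeGraph G Set.univ W).Adj (.inl u) (.inl w)) :
    Near (restr (edgeGraph G Set.univ W) (core G 𝔉 F H)) 4 (.inl w) (.inr F) := by
  obtain ⟨s, hs, hsF, hus, hsw⟩ := h.exists_adj_of_adj_link hF hH hFH.1 hu huF hw hwF huw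
  exact hsw.symm.trans (h.near_hub_of_adj hF hH hFH hu huF hs hsF hus)

theorem IsCHHF.hyp_augVerts (h : IsCHHF G W 𝔉 n δ) (hH : H ∈ 𝔉) :
    Hyp (edgeGraph G Set.univ W) (augVerts 𝔉 H) ⌈δ⌉₊ :=
  IsHyperbolic.hyp (h.hyperbolicity H hH).1

/-- CK is connected, so some edge of it leaves the link part. Either it joins two vertices of `K`,
or it ends at the projection vertex of a smaller domain, to which induction on the rank applies. -/
theorem IsCHHF.exists_near_hub_of_domain (h : IsCHHF G W 𝔉 n δ) (hF : F ∈ 𝔉) (hH : H ∈ 𝔉)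
    (hFH : F ⊂ H) (hK : K ∈ 𝔉) (hKH : K ⊆ H) {u : V} (hu : u ∈ K) (huF : u ∈ link G F)
    (hKF : ¬ K ⊆ link G F) :
    ∃ w ∈ K, w ∉ link G F ∧
      Near (restr (edgeGraph G Set.univ W) (core G 𝔉 F H)) 4 (.inl w) (.inr F) := by
  obtain ⟨r, -, hr⟩ := exists_rank h.factorSystem
  induction hm : r K using Nat.strong_induction_on generalizing K u with
  | _ m ih =>
    obtain ⟨w, hw, hwF⟩ := Set.not_subset.1 hKF
    obtain ⟨p⟩ := (h.hyp_augVerts hK).conn (.inl u) (inl_mem_augVerts.2 hu)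
      (.inl w) (inl_mem_augVerts.2 hw)
    obtain ⟨a, -, b, -, ⟨hab, haK, hbK⟩, haF, hbF⟩ := exists_adj_of_walk p
      (fun a ↦ a ∈ linkPart G 𝔉 F) (inl_mem_linkPart.2 huF) (mt inl_mem_linkPart.1 hwF)
    rcases a with a | J <;> rcases b with b | J'
    · rw [inl_mem_linkPart] at haF hbF
      rw [inl_mem_augVerts] at haK hbK
      exact ⟨b, hbK, hbF, h.near_hub_of_adj_link hF hH hFH (hKH haK) haF (hKH hbK) hbF hab⟩
    · rw [inl_mem_linkPart] at haF
      rw [inr_mem_augVerts] at hbK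
      rw [inr_mem_linkPart] at hbF
      obtain ⟨w, hw, hwF, hn⟩ := ih (r J') (hm ▸ hr J' hbK.1 K hK hbK.2) hbK.1
        (hbK.2.1.trans hKH) hab haF (fun hsub ↦ hbF ⟨hbK.1, hsub⟩) rfl
      exact ⟨w, hbK.2.1 hw, hwF, hn⟩
    · rw [inl_mem_linkPart] at hbF
      exact absurd ((inr_mem_linkPart.1 haF).2 hab) hbF
    · exact hab.elim

theorem IsCHHF.near_hub (h : IsCHHF G W 𝔉 n δ) (hF : F ∈ 𝔉) (hH : H ∈ 𝔉) (hFH : F ⊂ H)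
    {a b : V ⊕ Set V} (ha : a ∈ core G 𝔉 F H) (hb : b ∈ augVerts 𝔉 H)
    (hbF : b ∈ linkPart G 𝔉 F) (hab : (edgeGraph G Set.univ W).Adj a b) :
    Near (restr (edgeGraph G Set.univ W) (core G 𝔉 F H)) 5 a (.inr F) := by
  rcases a with w | K <;> rcases b with u | J
  · rw [inl_mem_core] at ha
    exact (h.near_hub_of_adj_link hF hH hFH (inl_mem_augVerts.1 hb) (inl_mem_linkPart.1 hbF)
      ha.1 ha.2 hab.symm).mono (by omega)
  · exact absurd ((inr_mem_linkPart.1 hbF).2 hab) (inl_mem_core.1 ha).2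
  · obtain ⟨⟨hK, hKH⟩, hKF⟩ := inr_mem_core.1 ha
    obtain ⟨w, hw, hwF, hn⟩ := h.exists_near_hub_of_domain hF hH hFH hK hKH.1 hab
      (inl_mem_linkPart.1 hbF) hKF
    have h1 : (restr (edgeGraph G Set.univ W) (core G 𝔉 F H)).Adj (.inr K) (.inl w) :=
      ⟨hw, ha, inl_mem_core.2 ⟨hKH.1 hw, hwF⟩⟩
    exact (Near.of_adj h1).trans hn
  · exact hab.elim

theorem IsCHHF.ssubset_of_mem_linkPart (h : IsCHHF G W 𝔉 n δ) (hFH : F ⊆ H)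
    {b : V ⊕ Set V} (hb : b ∈ augVerts 𝔉 H) (hbF : b ∈ linkPart G 𝔉 F) : F ⊂ H := by
  refine lt_of_le_of_ne hFH ?_
  rintro rfl
  rcases b with u | J
  · exact notMem_link_of_mem (inl_mem_augVerts.1 hb) (inl_mem_linkPart.1 hbF)
  · obtain ⟨hJ, hJF⟩ := inr_mem_linkPart.1 hbF
    obtain ⟨v, hv⟩ := h.factorSystem.nonempty_of_mem J hJ
    exact notMem_link_of_mem ((inr_mem_augVerts.1 hb).2.1 hv) (hJF hv)

/-- Each excursion into the link part is replaced by a visit to `b_F`, at cost 5 for each edge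
entering or leaving. The second conjunct carries the induction through the interior of an excursion.
-/
theorem IsCHHF.near_core (h : IsCHHF G W 𝔉 n δ) (hF : F ∈ 𝔉) (hH : H ∈ 𝔉) (hFH : F ⊆ H)
    {a b : V ⊕ Set V} (p : (restr (edgeGraph G Set.univ W) (augVerts 𝔉 H)).Walk a b)
    (hb : b ∈ core G 𝔉 F H) :
    (a ∈ core G 𝔉 F H →
      Near (restr (edgeGraph G Set.univ W) (core G 𝔉 F H)) (5 * p.length) a b) ∧
    (a ∈ augVerts 𝔉 H → a ∈ linkPart G 𝔉 F →
      Near (restr (edgeGraph G Set.univ W) (core G 𝔉 F H)) (5 * p.length) (.inr F) b) := by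
  induction p with
  | nil => exact ⟨fun _ ↦ Near.refl _ _ _, fun _ ha ↦ absurd ha hb.2⟩
  | @cons a v b hav p ih =>
    rw [SimpleGraph.Walk.length_cons]
    by_cases hv : v ∈ linkPart G 𝔉 F
    · have h1 := (ih hb).2 hav.2.2 hv
      have hFH' := h.ssubset_of_mem_linkPart hFH hav.2.2 hv
      refine ⟨fun ha ↦ ?_, fun _ _ ↦ h1.mono (by omega)⟩
      exact ((h.near_hub hF hH hFH' ha hav.2.2 hv hav.1).trans h1).mono (by omega)
    · have hv' : v ∈ core G 𝔉 F H := ⟨hav.2.2, hv⟩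
      have h1 := (ih hb).1 hv'
      constructor
      · intro ha
        have h2 : (restr (edgeGraph G Set.univ W) (core G 𝔉 F H)).Adj a v := ⟨hav.1, ha, hv'⟩
        exact ((Near.of_adj h2).trans h1).mono (by omega)
      · intro ha haF
        have hFH' := h.ssubset_of_mem_linkPart hFH ha haF
        exact ((h.near_hub hF hH hFH' hv' ha haF hav.1.symm).symm.trans h1).mono (by omega)

/-- The hyperbolicity constant of the augmented graphs without the link part. -/
def coreConst (δ : ℕ) : ℕ := 64 * (5 * (2 * 5 + δ + 1) + 1) ^ 2 + 2 * (5 * (2 * 5 + δ + 1))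

theorem IsCHHF.hyp_core (h : IsCHHF G W 𝔉 n δ) (hF : F ∈ 𝔉) (hH : H ∈ 𝔉) (hFH : F ⊆ H) :
    Hyp (edgeGraph G Set.univ W) (core G 𝔉 F H) (coreConst ⌈δ⌉₊) := by
  refine (h.hyp_augVerts hH).of_dense Set.sdiff_subset ?_ ?_
  · obtain ⟨f, hf⟩ := h.factorSystem.nonempty_of_mem F hF
    have hfH : Sum.inl f ∈ augVerts 𝔉 H := inl_mem_augVerts.2 (hFH hf)
    have hfc : Sum.inl f ∈ core G 𝔉 F H := inl_mem_core.2 ⟨hFH hf, notMem_link_of_mem hf⟩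
    have hlink : ∀ u ∈ H, u ∈ link G F → (restr (edgeGraph G Set.univ W) (augVerts 𝔉 H)).Adj
        (.inl u) (.inl f) := fun u hu huF ↦
      ⟨⟨fun e ↦ notMem_link_of_mem hf (e ▸ huF), Or.inl (huF f hf).symm⟩,
        inl_mem_augVerts.2 hu, hfH⟩
    intro v hv
    by_cases hvF : v ∈ linkPart G 𝔉 F
    · refine ⟨.inl f, hfc, ?_⟩
      rcases v with u | J
      · exact (Near.of_adj (hlink u (inl_mem_augVerts.1 hv) (inl_mem_linkPart.1 hvF))).mono
          (by omega)
      · obtain ⟨hJ, hJF⟩ := inr_mem_linkPart.1 hvF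
        obtain ⟨-, hJH⟩ := inr_mem_augVerts.1 hv
        obtain ⟨j, hj⟩ := h.factorSystem.nonempty_of_mem J hJ
        have h1 : (restr (edgeGraph G Set.univ W) (augVerts 𝔉 H)).Adj (.inr J) (.inl j) :=
          ⟨hj, hv, inl_mem_augVerts.2 (hJH.1 hj)⟩
        exact ((Near.of_adj h1).trans (Near.of_adj (hlink j (hJH.1 hj) (hJF hj)))).mono (by omega)
    · exact ⟨v, ⟨hv, hvF⟩, Near.refl _ _ _⟩
  · rintro m x hx y hy ⟨p, hp⟩
    exact ((h.near_core hF hH hFH p hy).1 hx).mono (Nat.mul_le_mul_left 5 hp)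

end domains

/-! ### Deleting the projection vertices of larger domains rank by rank, and projections to `F` -/

section levels

variable {V : Type*} {G : SimpleGraph V} {𝔉 : Set (Set V)} {n : ℕ} {F H K : Set V}
  {W : SimpleGraph (MaxClique G Set.univ)} {δ : ℝ} {r : Set V → ℕ} {k : ℕ}

/-- The projection vertices of the non-maximal domains that contain `F` and have rank `k`. -/
def levelCones (𝔉 : Set (Set V)) (F : Set V) (r : Set V → ℕ) (k : ℕ) : Set (V ⊕ Set V) :=
  {a | ∃ H ∈ 𝔉, F ⊆ H ∧ H ≠ Set.univ ∧ r H = k ∧ a = .inr H}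

/-- The vertices of `Y_F` and the projection vertices of the non-maximal domains that contain
`F` and have rank less than `k`. -/
def level (G : SimpleGraph V) (𝔉 : Set (Set V)) (F : Set V) (r : Set V → ℕ) (k : ℕ) :
    Set (V ⊕ Set V) :=
  {a | a ∈ complVerts G 𝔉 F ∨ ∃ i < k, a ∈ levelCones 𝔉 F r i}

theorem level_union_levelCones :
    level G 𝔉 F r k ∪ levelCones 𝔉 F r k = level G 𝔉 F r (k + 1) := by
  ext a
  simp only [level, Set.mem_union, Set.mem_ofPred_eq]
  constructor
  · rintro ((h | ⟨i, hi, h⟩) | h)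
    · exact Or.inl h
    · exact Or.inr ⟨i, by omega, h⟩
    · exact Or.inr ⟨k, by omega, h⟩
  · rintro (h | ⟨i, hi, h⟩)
    · exact Or.inl (Or.inl h)
    · rcases Nat.lt_succ_iff_lt_or_eq.1 hi with hi | rfl
      · exact Or.inl (Or.inr ⟨i, hi, h⟩)
      · exact Or.inr h

theorem inl_mem_complVerts {v : V} : .inl v ∈ complVerts G 𝔉 F ↔ v ∉ link G F := by
  simp [complVerts, augVerts, projPart]

theorem inr_mem_complVerts : .inr K ∈ complVerts G 𝔉 F ↔
    (K ∈ 𝔉 ∧ K ≠ Set.univ) ∧ ¬ K ⊆ link G F ∧ ¬ F ⊆ K := by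
  simp only [complVerts, augVerts, projPart, Set.mem_sdiff, Set.mem_ofPred_eq, reduceCtorEq,
    and_false, exists_false, false_or, Sum.inr.injEq, Set.ssubset_univ_iff]
  constructor
  · rintro ⟨⟨_, hH, hne, rfl⟩, h⟩
    exact ⟨⟨hH, hne⟩, fun hl ↦ h (Or.inl ⟨_, hH, hl, rfl⟩),
      fun hl ↦ h (Or.inr ⟨_, hH, hne, hl, rfl⟩)⟩
  · rintro ⟨⟨hK, hne⟩, h1, h2⟩
    refine ⟨⟨K, hK, hne, rfl⟩, ?_⟩
    rintro (⟨_, _, hl, rfl⟩ | ⟨_, _, _, hl, rfl⟩)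
    · exact h1 hl
    · exact h2 hl

theorem inl_mem_level {v : V} : .inl v ∈ level G 𝔉 F r k ↔ v ∉ link G F := by
  simp [level, levelCones, inl_mem_complVerts]

theorem inr_mem_level_of_subset (hFK : F ⊆ K) :
    .inr K ∈ level G 𝔉 F r k ↔ K ∈ 𝔉 ∧ K ≠ Set.univ ∧ r K < k := by
  simp only [level, levelCones, Set.mem_ofPred_eq, inr_mem_complVerts, Sum.inr.injEq]
  constructor
  · rintro (⟨-, -, h⟩ | ⟨i, hi, _, hK, -, hne, rfl, rfl⟩)
    · exact absurd hFK h
    · exact ⟨hK, hne, hi⟩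
  · rintro ⟨hK, hne, hlt⟩
    exact Or.inr ⟨r K, hlt, K, hK, hFK, hne, rfl, rfl⟩

theorem inr_mem_level_of_not_subset (hFK : ¬ F ⊆ K) :
    .inr K ∈ level G 𝔉 F r k ↔ (K ∈ 𝔉 ∧ K ≠ Set.univ) ∧ ¬ K ⊆ link G F := by
  simp only [level, levelCones, Set.mem_ofPred_eq, inr_mem_complVerts, Sum.inr.injEq]
  constructor
  · rintro (⟨h1, h2, -⟩ | ⟨i, hi, _, hK, hFK', -, -, rfl⟩)
    · exact ⟨h1, h2⟩
    · exact absurd hFK' hFK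
  · rintro ⟨h1, h2⟩
    exact Or.inl ⟨h1, h2, hFK⟩

theorem complVerts_subset_level : complVerts G 𝔉 F ⊆ level G 𝔉 F r k := fun _ h ↦ Or.inl h

theorem level_subset_augVerts : level G 𝔉 F r k ⊆ augVerts 𝔉 Set.univ := by
  rintro a (h | ⟨i, -, H, hH, -, hne, -, rfl⟩)
  · exact h.1
  · exact inr_mem_augVerts.2 ⟨hH, Set.ssubset_univ_iff.2 hne⟩

theorem level_eq_core (hF : F.Nonempty) (hr : ∀ H ∈ 𝔉, r H < n) :
    level G 𝔉 F r n = core G 𝔉 F Set.univ := by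
  ext a
  rcases a with v | K
  · rw [inl_mem_level, inl_mem_core]
    simp
  · rw [inr_mem_core, Set.ssubset_univ_iff]
    by_cases hFK : F ⊆ K
    · rw [inr_mem_level_of_subset hFK]
      have := not_subset_link (G := G) hF hFK
      have := hr K
      tauto
    · rw [inr_mem_level_of_not_subset hFK]

/-- Domains strictly above `H` have larger rank and are already gone, so `b_H` is the only vertex of
`PH` left. For `H = F` this says that deleting `b_F` ends inside `Y_F`. -/
theorem level_succ_sdiff_subset (hF : F.Nonempty) (hH : H ∈ 𝔉) (hFH : F ⊆ H)
    (hr : ∀ H ∈ 𝔉, ∀ K ∈ 𝔉, H ⊂ K → r H < r K) :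
    level G 𝔉 F r (r H + 1) \ {.inr H} ⊆ complVerts G 𝔉 H := by
  have hlink : link G H ⊆ link G F := fun v hv u hu ↦ hv u (hFH hu)
  rintro a ⟨ha, hne⟩
  rcases a with v | K
  · rw [inl_mem_level] at ha
    exact inl_mem_complVerts.2 fun h ↦ ha (hlink h)
  · rw [inr_mem_complVerts]
    by_cases hFK : F ⊆ K
    · obtain ⟨hK, hK', hlt⟩ := (inr_mem_level_of_subset hFK).1 ha
      refine ⟨⟨hK, hK'⟩, fun h ↦ not_subset_link hF hFK (h.trans hlink), fun hHK ↦ ?_⟩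
      have := hr H hH K hK (lt_of_le_of_ne hHK fun e ↦ hne (by rw [e]; rfl))
      omega
    · obtain ⟨h1, h2⟩ := (inr_mem_level_of_not_subset hFK).1 ha
      exact ⟨h1, fun h ↦ h2 (h.trans hlink), fun h ↦ hFK (hFH.trans h)⟩

/-- The subgraph that replaces the projection vertex of a domain. -/
def coneCore (G : SimpleGraph V) (𝔉 : Set (Set V)) (F : Set V) : V ⊕ Set V → Set (V ⊕ Set V)
  | .inl _ => ∅
  | .inr H => core G 𝔉 F H

theorem IsQIEmbedding.dist_le {A B : Type*} {E : SimpleGraph A} {E' : SimpleGraph B} {f : A → B}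
    (hδ : 0 < δ) (h : IsQIEmbedding E E' δ f) {a b : A} {m : ℕ} (hab : Near E' m (f a) (f b)) :
    (E.dist a b : ℝ) ≤ δ * (m + δ) := by
  have h1 := (h a b).2.1
  have h2 : (E'.dist (f a) (f b) : ℝ) ≤ m := by exact_mod_cast hab.dist_le
  have h3 : (E.dist a b : ℝ) / δ ≤ m + δ := by linarith
  rw [div_le_iff₀ hδ] at h3
  linarith

/-- The distortion constant of the cone cores. -/
def distortionConst (δ : ℕ) : ℕ := 5 * (δ * (1 + δ))

theorem IsCHHF.near_core_of_near (h : IsCHHF G W 𝔉 n δ) (hδ : 0 < δ) (hF : F ∈ 𝔉) (hH : H ∈ 𝔉)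
    (hFH : F ⊆ H) {a b : V ⊕ Set V} (ha : a ∈ core G 𝔉 F H) (hb : b ∈ core G 𝔉 F H) {m : ℕ}
    (hab : Near (restr (edgeGraph G Set.univ W) (complVerts G 𝔉 H)) m a b) :
    Near (restr (edgeGraph G Set.univ W) (core G 𝔉 F H)) (distortionConst ⌈δ⌉₊ * (m + 1)) a b := by
  have hsub := augVerts_subset_complVerts h.factorSystem H
  have h1 : Near (complGraph G 𝔉 W H) m (Set.inclusion hsub ⟨a, ha.1⟩)
      (Set.inclusion hsub ⟨b, hb.1⟩) :=
    (near_restr_iff (x := ⟨a, hsub ha.1⟩) (y := ⟨b, hsub hb.1⟩)).1 hab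
  have h2 := (h.hyperbolicity H hH).2.dist_le hδ h1
  have h3 : (augGraph G 𝔉 Set.univ W H).dist ⟨a, ha.1⟩ ⟨b, hb.1⟩ ≤ ⌈δ⌉₊ * (1 + ⌈δ⌉₊) * (m + 1) := by
    have h4 : δ * (m + δ) ≤ (⌈δ⌉₊ : ℝ) * (m + ⌈δ⌉₊) := by
      have := Nat.le_ceil δ
      gcongr
    have h5 : (⌈δ⌉₊ : ℝ) * (m + ⌈δ⌉₊) ≤ ⌈δ⌉₊ * (1 + ⌈δ⌉₊) * (m + 1) := by
      rw [mul_assoc]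
      gcongr
      have h6 : (0 : ℝ) ≤ m := Nat.cast_nonneg m
      have h7 : (0 : ℝ) ≤ ⌈δ⌉₊ := Nat.cast_nonneg _
      nlinarith
    exact_mod_cast h2.trans (h4.trans h5)
  obtain ⟨p, hp⟩ := near_restr_iff.2 (near_of_dist_le
    ((h.hyperbolicity H hH).1.1.preconnected ⟨a, ha.1⟩ ⟨b, hb.1⟩) h3)
  refine ((h.near_core hF hH hFH p hb).1 ha).mono ?_
  exact (Nat.mul_le_mul_left 5 hp).trans (le_of_eq (by rw [distortionConst, ← mul_assoc]))

/-- The hyperbolicity constant of the graph obtained by removing `j` levels of cones. -/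
def levelConst (δ : ℕ) : ℕ → ℕ
  | 0 => coreConst δ
  | j + 1 => levelConst δ j +
      (64 * (ConeSystem.guessConst (levelConst δ j) (distortionConst δ) + 1) ^ 2 +
        2 * ConeSystem.guessConst (levelConst δ j) (distortionConst δ))

/-- Monotonicity is forced by the first summand of the recursion. It keeps the constants above
`coreConst δ` and lets the value at `n` serve domains of every rank. -/
theorem levelConst_mono (δ : ℕ) : Monotone (levelConst δ) :=
  monotone_nat_of_le_succ fun j ↦ by rw [levelConst]; omega

theorem IsCHHF.coneSystem (h : IsCHHF G W 𝔉 n δ) (hδ : 0 < δ) (hF : F ∈ 𝔉)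
    (hr : ∀ H ∈ 𝔉, ∀ K ∈ 𝔉, H ⊂ K → r H < r K) {δ' : ℕ} (hδ' : coreConst ⌈δ⌉₊ ≤ δ')
    (hyp : Hyp (edgeGraph G Set.univ W) (level G 𝔉 F r (k + 1)) δ') :
    ConeSystem (edgeGraph G Set.univ W) (level G 𝔉 F r k) (levelCones 𝔉 F r k) (coneCore G 𝔉 F)
      δ' (distortionConst ⌈δ⌉₊) where
  notMem := by
    rintro _ ⟨H, hH, hFH, hne, rfl, rfl⟩ hmem
    have := ((inr_mem_level_of_subset hFH).1 hmem).2.2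
    omega
  hyp := by rwa [level_union_levelCones]
  indep := by
    rintro _ ⟨H, hH, hFH, hne, rfl, rfl⟩ (v | K) hv hadj
    · rw [level_union_levelCones, inl_mem_level] at hv
      exact inl_mem_level.2 hv
    · exact hadj.elim
  cone_subset := by
    rintro _ ⟨H, hH, hFH, hne, rfl, rfl⟩ (v | K) hv
    · exact inl_mem_level.2 (inl_mem_core.1 hv).2
    · obtain ⟨⟨hK, hKH⟩, hKF⟩ := inr_mem_core.1 hv
      have hK' : K ≠ Set.univ := fun e ↦ hKH.2 (e ▸ Set.subset_univ H)
      by_cases hFK : F ⊆ K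
      · exact (inr_mem_level_of_subset hFK).2
          ⟨hK, hK', hr K hK H hH hKH⟩
      · exact (inr_mem_level_of_not_subset hFK).2 ⟨⟨hK, hK'⟩, hKF⟩
  mem_cone := by
    rintro _ ⟨H, hH, hFH, hne, rfl, rfl⟩ (v | K) hv hadj
    · exact inl_mem_core.2 ⟨hadj, inl_mem_level.1 hv⟩
    · exact hadj.elim
  hyp_cone := by
    rintro _ ⟨H, hH, hFH, hne, rfl, rfl⟩
    exact (h.hyp_core hF hH hFH).mono hδ'
  undistorted := by
    rintro _ ⟨H, hH, hFH, hne, rfl, rfl⟩ a ha b hb m hab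
    rw [level_union_levelCones] at hab
    exact h.near_core_of_near hδ hF hH hFH ha hb (hab.mono_graph (restr_mono
      (level_succ_sdiff_subset (h.factorSystem.nonempty_of_mem F hF) hH hFH hr)))

/-- Descending induction on the rank, starting at `k = n`, where only the link part is missing. -/
theorem IsCHHF.hyp_level (h : IsCHHF G W 𝔉 n δ) (hδ : 0 < δ) (hF : F ∈ 𝔉)
    (hrn : ∀ H ∈ 𝔉, r H < n) (hr : ∀ H ∈ 𝔉, ∀ K ∈ 𝔉, H ⊂ K → r H < r K) (j : ℕ) :
    ∀ k, k + j = n → Hyp (edgeGraph G Set.univ W) (level G 𝔉 F r k) (levelConst ⌈δ⌉₊ j) := by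
  induction j with
  | zero =>
    rintro k rfl
    rw [add_zero] at hrn
    rw [level_eq_core (h.factorSystem.nonempty_of_mem F hF) hrn]
    exact h.hyp_core hF h.factorSystem.univ_mem (Set.subset_univ F)
  | succ j ih =>
    intro k hk
    refine (h.coneSystem hδ hF hr (levelConst_mono _ (Nat.zero_le j))
      (ih (k + 1) (by omega))).hyp_base.mono ?_
    rw [levelConst]
    omega

/-- The vertices of the closest-point projection are close to the gates at the projection vertex
of `F`. -/
theorem IsCHHF.near_gate_of_mem_closestProj (h : IsCHHF G W 𝔉 n δ) (hF : F ∈ 𝔉)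
    (hF' : F ≠ Set.univ) (hr : ∀ H ∈ 𝔉, ∀ K ∈ 𝔉, H ⊂ K → r H < r K) {D : ℕ}
    (hyp : Hyp (edgeGraph G Set.univ W) (level G 𝔉 F r (r F + 1)) D) {x : complVerts G 𝔉 F}
    {a : augVerts 𝔉 F} (ha : a ∈ closestProj h.factorSystem W F x) {a₀ : V ⊕ Set V}
    (ha₀ : IsGate (restr (edgeGraph G Set.univ W) (level G 𝔉 F r (r F + 1))) (.inr F) x.1 a₀) :
    Near (restr (edgeGraph G Set.univ W) (complVerts G 𝔉 F)) (8 * D + 9) a₀ a.1 := by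
  set E := edgeGraph G Set.univ W
  set Z := restr E (level G 𝔉 F r (r F + 1)) with hZ
  have hne := h.factorSystem.nonempty_of_mem F hF
  have hFl : Sum.inr F ∈ level G 𝔉 F r (r F + 1) :=
    (inr_mem_level_of_subset le_rfl).2 ⟨hF, hF', by omega⟩
  have hsub := augVerts_subset_complVerts h.factorSystem F
  have hoff : restr Z {.inr F}ᶜ ≤ restr E (complVerts G 𝔉 F) := by
    rw [hZ, restr_restr_compl]
    exact restr_mono (level_succ_sdiff_subset hne hF le_rfl hr)
  have hFc : Sum.inr F ∉ complVerts G 𝔉 F := fun hmem ↦ (inr_mem_complVerts.1 hmem).2.2 le_rfl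
  obtain ⟨q, hadj, hq⟩ := id ha₀
  rcases a₀ with f | K
  swap
  · exact hadj.1.elim
  have hfF : f ∈ F := hadj.1
  have hqn := (near_off_of_mem (notMem_support_of_isGeodesic_concat hq)).mono_graph hoff
  have hfa : Sum.inl f ∈ augVerts 𝔉 F := inl_mem_augVerts.2 hfF
  -- The gate lies in `F`, so `q` bounds the distance from `x` to `CF`. Allowing the extra one in
  -- the projection, `η` is still no longer than a geodesic to `b_F`.
  obtain ⟨η, hη⟩ : Near (complGraph G 𝔉 W F) (q.length + 1) x (Set.inclusion hsub a) := by
    have h1 : Near (complGraph G 𝔉 W F) q.length x (Set.inclusion hsub ⟨.inl f, hfa⟩) :=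
      (near_restr_iff (x := x) (y := ⟨.inl f, hsub hfa⟩)).1 hqn
    obtain ⟨s, hs⟩ := h1
    have h2 : (complGraph G 𝔉 W F).edist x (Set.inclusion hsub a) ≤ ((q.length + 1 : ℕ) : ℕ∞) := by
      refine le_trans ha ?_
      push_cast
      gcongr
      refine (iInf_le _ ⟨.inl f, hfa⟩).trans ((SimpleGraph.edist_le s).trans ?_)
      exact_mod_cast hs
    obtain ⟨t, ht⟩ := SimpleGraph.exists_walk_of_edist_ne_top
      (ne_top_of_le_ne_top (ENat.natCast_ne_top _) h2)
    refine ⟨t, ?_⟩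
    rw [← ht] at h2
    exact_mod_cast h2
  obtain ⟨η₁, hη₁, hs₁⟩ := exists_walk_restr η
  have hle : restr E (complVerts G 𝔉 F) ≤ Z := restr_mono complVerts_subset_level
  have hηF : Sum.inr F ∉ (η₁.mapLe hle).support := by
    rw [SimpleGraph.Walk.support_mapLe_eq_support]
    exact fun hmem ↦ hFc (mem_of_mem_support_restr x.2 η₁ _ hmem)
  have hlvl : ∀ {v : V}, v ∈ F → Sum.inl v ∈ level G 𝔉 F r (r F + 1) :=
    fun hv ↦ inl_mem_level.2 (notMem_link_of_mem hv)
  have haF : Near Z 2 a.1 (.inr F) := by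
    have hadj : ∀ {K : Set V} {v : V}, v ∈ K → E.Adj (.inl v) (.inr K) := fun hv ↦ hv
    obtain ⟨a | K, haF⟩ := a
    · have h1 := inl_mem_augVerts.1 haF
      exact (Near.of_adj (H := Z) ⟨hadj h1, hlvl h1, hFl⟩).mono (by omega)
    · obtain ⟨hK, hKF⟩ := inr_mem_augVerts.1 haF
      obtain ⟨v, hv⟩ := h.factorSystem.nonempty_of_mem K hK
      exact (Near.of_adj (H := Z) ⟨(hadj hv).symm, Or.inl (hsub haF), hlvl (hKF.1 hv)⟩).trans
        (Near.of_adj (H := Z) ⟨hadj (hKF.1 hv), hlvl (hKF.1 hv), hFl⟩)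
  refine (gate_near_of_walk hyp.slim (η₁.mapLe hle) hηF (fun p ↦ ?_) haF ha₀).mono_graph hoff
  have := hq.length_le p
  rw [SimpleGraph.Walk.length_concat] at this
  rw [SimpleGraph.Walk.length_mapLe]
  exact (hη₁.trans_le hη).trans this

/-- Closest-point projections of the ends of a geodesic avoiding the projection part are close. -/
theorem IsCHHF.near_closestProj (h : IsCHHF G W 𝔉 n δ) (hF : F ∈ 𝔉) (hF' : F ≠ Set.univ)
    (hr : ∀ H ∈ 𝔉, ∀ K ∈ 𝔉, H ⊂ K → r H < r K) {D : ℕ}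
    (hyp : Hyp (edgeGraph G Set.univ W) (level G 𝔉 F r (r F + 1)) D) {x y : complVerts G 𝔉 F}
    {a b : augVerts 𝔉 F} (ha : a ∈ closestProj h.factorSystem W F x)
    (hb : b ∈ closestProj h.factorSystem W F y)
    (γ : (augGraph G 𝔉 Set.univ W Set.univ).Walk (Set.inclusion (complVerts_subset G 𝔉 F) x)
      (Set.inclusion (complVerts_subset G 𝔉 F) y)) (hγ : IsGeodesic γ)
    (hγF : ∀ v ∈ γ.support, v.1 ∉ projPart G 𝔉 F) :
    Near (restr (edgeGraph G Set.univ W) (complVerts G 𝔉 F)) (24 * D + 24) a.1 b.1 := by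
  have hne := h.factorSystem.nonempty_of_mem F hF
  have hFl : Sum.inr F ∈ level G 𝔉 F r (r F + 1) :=
    (inr_mem_level_of_subset le_rfl).2 ⟨hF, hF', by omega⟩
  have hFc : Sum.inr F ∉ complVerts G 𝔉 F := fun hmem ↦ (inr_mem_complVerts.1 hmem).2.2 le_rfl
  have hgate : ∀ x : complVerts G 𝔉 F, ∃ a₀, IsGate (restr (edgeGraph G Set.univ W)
      (level G 𝔉 F r (r F + 1))) (.inr F) x.1 a₀ := fun x ↦
    exists_isGate (hyp.conn x.1 (Or.inl x.2) _ hFl) (fun e ↦ hFc (e ▸ x.2))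
  obtain ⟨a₀, ha₀⟩ := hgate x
  obtain ⟨b₀, hb₀⟩ := hgate y
  obtain ⟨γ₁, hγ₁, hs₁⟩ := exists_walk_restr γ
  have hmem : ∀ v ∈ γ₁.support, v ∈ complVerts G 𝔉 F := by
    intro v hv
    rw [hs₁, List.mem_map] at hv
    obtain ⟨v, hv, rfl⟩ := hv
    exact ⟨v.2, hγF v hv⟩
  obtain ⟨γ₂, hγ₂⟩ := near_restr_of_walk γ₁ hmem
  -- Shortest in CX implies shortest in the smaller graph obtained from `Y_F` by adding `b_F`.
  have hγ₂geo : ∀ p : (restr (edgeGraph G Set.univ W) (augVerts 𝔉 Set.univ)).Walk x.1 y.1,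
      γ₂.length ≤ p.length := fun p ↦
    hγ₂.trans (((isGeodesic_induce_iff hγ₁.symm).1 hγ).length_le p)
  have hle₁ : restr (restr (edgeGraph G Set.univ W) (augVerts 𝔉 Set.univ)) (complVerts G 𝔉 F) ≤
      restr (edgeGraph G Set.univ W) (level G 𝔉 F r (r F + 1)) :=
    fun _ _ huv ↦ ⟨huv.1.1, Or.inl huv.2.1, Or.inl huv.2.2⟩
  have hgeo : IsGeodesic (γ₂.mapLe hle₁) := by
    rw [isGeodesic_iff]
    intro p
    have := hγ₂geo (p.mapLe (restr_mono level_subset_augVerts))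
    rw [SimpleGraph.Walk.length_mapLe] at this ⊢
    exact this
  have hoff : Sum.inr F ∉ (γ₂.mapLe hle₁).support := by
    rw [SimpleGraph.Walk.support_mapLe_eq_support]
    exact fun hv ↦ hFc (mem_of_mem_support_restr x.2 γ₂ _ hv)
  have h1 := gate_near hyp.slim hgeo hoff ha₀ hb₀
  rw [restr_restr_compl] at h1
  have h2 := h1.mono_graph (restr_mono (level_succ_sdiff_subset hne hF le_rfl hr))
  exact (((h.near_gate_of_mem_closestProj hF hF' hr hyp ha ha₀).symm.trans h2).trans
    (h.near_gate_of_mem_closestProj hF hF' hr hyp hb hb₀)).mono (by omega)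

end levels

end CHHF

/-! ### The bounded geodesic image lemma -/

theorem lemma3p22 (n : ℕ) (δ : ℝ) (hδ : 0 < δ) :
    ∃ C : ℝ, ∀ (V : Type*) (G : SimpleGraph V) (W : SimpleGraph (CHHF.MaxClique G Set.univ))
      (𝔉 : Set (Set V)) (h : CHHF.IsCHHF G W 𝔉 n δ) (F : Set V), F ∈ 𝔉 → F ≠ Set.univ →
      ∀ x y : CHHF.complVerts G 𝔉 F,
        ∀ a ∈ CHHF.closestProj h.factorSystem W F x,
        ∀ b ∈ CHHF.closestProj h.factorSystem W F y,
          C ≤ ((CHHF.augGraph G 𝔉 Set.univ W F).dist a b : ℝ) →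
          ∀ γ : (CHHF.augGraph G 𝔉 Set.univ W Set.univ).Walk
              (Set.inclusion (CHHF.complVerts_subset G 𝔉 F) x)
              (Set.inclusion (CHHF.complVerts_subset G 𝔉 F) y),
            CHHF.IsGeodesic γ → ∃ v ∈ γ.support, v.1 ∈ CHHF.projPart G 𝔉 F := by
  -- The lower quasi-isometry bound turns the distance `24 * D + 24` in `Y_F` into the first
  -- summand; the final 1 makes the contradiction strict.
  refine ⟨δ * ((24 * CHHF.levelConst ⌈δ⌉₊ n + 24 : ℕ) + δ) + 1, ?_⟩
  intro V G W 𝔉 h F hF hF' x y a ha b hb hC γ hγ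
  by_contra! hcon
  obtain ⟨r, hrn, hr⟩ := CHHF.exists_rank h.factorSystem
  -- At level `r F + 1` the only domain containing `F` whose projection vertex remains is `F`
  -- itself.
  have hyp := (h.hyp_level hδ hF hrn hr (n - (r F + 1)) (r F + 1)
    (by have := hrn F hF; omega)).mono (CHHF.levelConst_mono _ (Nat.sub_le n (r F + 1)))
  have h1 := h.near_closestProj hF hF' hr hyp ha hb γ hγ hcon
  have hsub := CHHF.augVerts_subset_complVerts h.factorSystem F
  have h2 := (h.hyperbolicity F hF).2.dist_le hδ
    ((CHHF.near_restr_iff (x := ⟨a.1, hsub a.2⟩) (y := ⟨b.1, hsub b.2⟩)).1 h1)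
  linarith
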